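/- In **L-Sided Pricing** an instance is a finite bipartite graph with sides $L,R$ and edge set $E$ (parallel edges allowed), vertex capacities $\mu_v\in\mathbb Z_{\ge 0}\cup\{\infty\}$ and edge budgets $b_e\ge 0$. A solution consists of prices $p:L\to\mathbb R_{\ge 0}$ (vertices of $R$ have price $0$) and a set $F\subseteq E$. It is *feasible* if $p(u)\le b_e$ for every $e=uv\in F$ with $u\in L$, and every vertex $v\in L\cup R$ is an endpoint of at most $\mu_v$ edges of $F$. Its revenue is $\sum_{e=uv\in F,\,u\in L}p(u)$, to be maximized. Let $\mathrm{val}(p)$ be the maximum revenue of a feasible solution with prices $p$, and for $u\in L$ let $P_u=\{b_e: e \text{ is incident to } u\}$. A *single-price change* of $p$ replaces $p(u)$ by an element of $P_u$ for one $u\in L$; $p$ is *locally optimal* if no single-price change $p'$ has $\mathrm{val}(p')>\mathrm{val}(p)$. **Theorem.** 1. There is a polynomial-time 2-approximation algorithm for L-Sided Pricing: given an instance with rational budgets, it outputs, in time polynomial in the total bit length of the instance (on a random access machine with logarithmic cost), a feasible solution $(p,F)$ whose revenue is at least half of the revenue of every feasible solution. 2. For all real budgets, if $p$ is a locally optimal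 pricing, then $\mathrm{val}(p)\ge \mathrm{val}(p^*)/2$ for every pricing $p^*:L\to\mathbb R_{\ge 0}$, in particular for an optimal one. 3. There is a polynomial $P$ such that for every instance with rational budgets, of total bit length $N$, the following holds. Let $p_0$ be any pricing with $p_0(u)\in P_u$ for each $u\in L$ that is incident to some edge, and let $p_0,p_1,p_2,\dots$ be a sequence in which each $p_{k+1}$ has the largest value of $\mathrm{val}$ among $p_k$ and all single-price changes of $p_k$. Then $\mathrm{val}(p_k)\ge \mathrm{val}(p^*)/2$ for every $k\ge P(N)$ and every pricing $p^*:L\to\mathbb R_{\ge 0}$. -/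

import Mathlib

open scoped NNReal

/-! ## Random access machines with logarithmic cost

Programs are structured programs over finitely many memory banks; every memory cell holds a
natural number. Each elementary operation costs one plus the bit lengths of all numbers involved
(operands, results, addresses), so running time is polynomially related to that of a Turing
machine. -/

namespace RAM

/-- `s b i` is the content of cell `i` of memory bank `b`. -/
abbrev Store : Type := ℕ → ℕ → ℕ

/-- Arithmetic and comparison operations on natural numbers. -/
inductive Op
  | add | sub | mul | div | eq | lt

/-- Subtraction is truncated, `div` is rounded down (with `a / 0 = 0`), and the comparisons
return `1` or `0`. -/
def Op.eval : Op → ℕ → ℕ → ℕ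
  | .add, a, b => a + b
  | .sub, a, b => a - b
  | .mul, a, b => a * b
  | .div, a, b => a / b
  | .eq, a, b => if a = b then 1 else 0
  | .lt, a, b => if a < b then 1 else 0

/-- Expressions: constants, memory reads (the bank is fixed, the address is computed), operations. -/
inductive Expr
  | const (n : ℕ)
  | read (bank : ℕ) (address : Expr)
  | op (o : Op) (a b : Expr)

/-- The value of an expression. -/
def Expr.eval (s : Store) : Expr → ℕ
  | .const n => n
  | .read b a => s b (a.eval s)
  | .op o a b => o.eval (a.eval s) (b.eval s)

/-- The number of bit operations charged for evaluating an expression (`Nat.size` is the number of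
binary digits). -/
def Expr.cost (s : Store) : Expr → ℕ
  | .const n => 1 + n.size
  | .read b a => a.cost s + (1 + (a.eval s).size + (s b (a.eval s)).size)
  | .op o a b => a.cost s + b.cost s +
      (1 + (a.eval s).size + (b.eval s).size + (o.eval (a.eval s) (b.eval s)).size)

/-- Programs. A test is passed if its expression has a nonzero value. -/
inductive Prog
  | skip
  | assign (bank : ℕ) (address value : Expr)
  | seq (c d : Prog)
  | ite (test : Expr) (c d : Prog)
  | while (test : Expr) (c : Prog)

/-- The store after writing `x` to cell `i` of bank `b`. -/
def Store.write (s : Store) (b i x : ℕ) : Store :=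
  Function.update s b (Function.update (s b) i x)

/-- `Exec c s t s'`: the program `c`, started in the store `s`, halts in the store `s'` after
running for time `t`. -/
inductive Exec : Prog → Store → ℕ → Store → Prop
  | skip (s : Store) : Exec .skip s 1 s
  | assign (s : Store) (b : ℕ) (a e : Expr) :
      Exec (.assign b a e) s
        (a.cost s + e.cost s + (1 + (a.eval s).size + (e.eval s).size))
        (s.write b (a.eval s) (e.eval s))
  | seq {c d : Prog} {s s₁ s₂ : Store} {t₁ t₂ : ℕ} :
      Exec c s t₁ s₁ → Exec d s₁ t₂ s₂ → Exec (.seq c d) s (t₁ + t₂) s₂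
  | ite_true {e : Expr} {c d : Prog} {s s₁ : Store} {t : ℕ} :
      e.eval s ≠ 0 → Exec c s t s₁ → Exec (.ite e c d) s (e.cost s + 1 + t) s₁
  | ite_false {e : Expr} {c d : Prog} {s s₁ : Store} {t : ℕ} :
      e.eval s = 0 → Exec d s t s₁ → Exec (.ite e c d) s (e.cost s + 1 + t) s₁
  | while_true {e : Expr} {c : Prog} {s s₁ s₂ : Store} {t₁ t₂ : ℕ} :
      e.eval s ≠ 0 → Exec c s t₁ s₁ → Exec (.while e c) s₁ t₂ s₂ →
        Exec (.while e c) s (e.cost s + 1 + t₁ + t₂) s₂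
  | while_false {e : Expr} {c : Prog} {s : Store} :
      e.eval s = 0 → Exec (.while e c) s (e.cost s + 1) s

/-- The initial store: the input is written in bank `0`, all other cells hold `0`. -/
def initStore (input : List ℕ) : Store :=
  fun b i => if b = 0 then input.getD i 0 else 0

/-- The bit length of an input (each number is charged its binary digits and a separator). -/
def bitLength (input : List ℕ) : ℕ :=
  (input.map fun n => n.size + 1).sum

/-- There is a polynomial-time algorithm for the search problem with inputs `x : X`, given to the
machine as `encode x`, that asks for an output `out` with `Good x out`. The program and the
polynomial do not depend on the input; the output is read from bank `1` on termination. -/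
def PolyTimeSolvable {X : Type*} (encode : X → List ℕ) (Good : X → (ℕ → ℕ) → Prop) : Prop :=
  ∃ (c : Prog) (P : Polynomial ℕ), ∀ x : X, ∃ (t : ℕ) (s : Store),
    Exec c (initStore (encode x)) t s ∧ t ≤ P.eval (bitLength (encode x)) ∧ Good x (s 1)

end RAM

/-! ## L-Sided Pricing -/

/-- An instance of L-Sided Pricing: a bipartite graph with sides `L`, `R` whose edges (customers)
are the elements of `E`, parallel edges being allowed, with vertex capacities in
`ℕ ∪ {∞}` and nonnegative budgets. -/
structure PricingInstance (L R E : Type*) where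
  left : E → L
  right : E → R
  capL : L → ℕ∞
  capR : R → ℕ∞
  budget : E → ℝ≥0

namespace PricingInstance

/-- Prices of vertices of `R` are `0`, so a price vector is given by its values on `L`, and the
customer `e` pays `p (I.left e)`. `(p, F)` is feasible if each customer in `F` can afford its bundle
and no item is oversold. -/
def Feasible {L R E : Type*} (I : PricingInstance L R E) (p : L → ℝ≥0) (F : Finset E) : Prop :=
  (∀ e ∈ F, p (I.left e) ≤ I.budget e) ∧
  (∀ u : L, Set.encard {e : E | e ∈ F ∧ I.left e = u} ≤ I.capL u) ∧
  (∀ v : R, Set.encard {e : E | e ∈ F ∧ I.right e = v} ≤ I.capR v)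

/-- The revenue of `(p, F)`. -/
def revenue {L R E : Type*} (I : PricingInstance L R E) (p : L → ℝ≥0) (F : Finset E) : ℝ≥0 :=
  ∑ e ∈ F, p (I.left e)

open Classical in
/-- `val p` is the maximum revenue of a feasible solution with prices `p`
(`(p, ∅)` is always feasible). -/
noncomputable def val {L R E : Type*} [Fintype E] (I : PricingInstance L R E)
    (p : L → ℝ≥0) : ℝ≥0 :=
  (Finset.univ.filter fun F : Finset E => I.Feasible p F).sup (I.revenue p)

/-- `P_u`, the set of budgets of customers interested in `u`. -/
def priceSet {L R E : Type*} (I : PricingInstance L R E) (u : L) : Set ℝ≥0 :=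
  {q | ∃ e : E, I.left e = u ∧ I.budget e = q}

/-- The price of every item of `L` is the budget of a customer interested in it; for an item in
which no customer is interested the price is immaterial and may be anything. -/
def IsBudgetPricing {L R E : Type*} (I : PricingInstance L R E) (p : L → ℝ≥0) : Prop :=
  ∀ u : L, (I.priceSet u).Nonempty → p u ∈ I.priceSet u

open Classical in
/-- `p'` equals `p` or arises from `p` by changing the price of a single `u` to an element
of `P_u`. -/
def IsSwap {L R E : Type*} (I : PricingInstance L R E) (p p' : L → ℝ≥0) : Prop :=
  p' = p ∨ ∃ u : L, ∃ q ∈ I.priceSet u, p' = Function.update p u q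

/-- No change of a single price improves `val`. -/
def LocallyOptimal {L R E : Type*} [Fintype E] (I : PricingInstance L R E)
    (p : L → ℝ≥0) : Prop :=
  ∀ p' : L → ℝ≥0, I.IsSwap p p' → I.val p' ≤ I.val p

/-- One iteration of single-swap local search: pass from `p` to a best swap `p'`. -/
def IsBestSwap {L R E : Type*} [Fintype E] (I : PricingInstance L R E)
    (p p' : L → ℝ≥0) : Prop :=
  I.IsSwap p p' ∧ ∀ p'' : L → ℝ≥0, I.IsSwap p p'' → I.val p'' ≤ I.val p'

end PricingInstance

/-- An instance of L-Sided Pricing as the input of an algorithm: vertices and edges are numbered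
and budgets are rational. -/
structure PricingInput where
  numL : ℕ
  numR : ℕ
  numE : ℕ
  left : Fin numE → Fin numL
  right : Fin numE → Fin numR
  capL : Fin numL → ℕ∞
  capR : Fin numR → ℕ∞
  budget : Fin numE → ℚ≥0

namespace PricingInput

/-- The instance given by an input. -/
noncomputable def toInstance (X : PricingInput) :
    PricingInstance (Fin X.numL) (Fin X.numR) (Fin X.numE) where
  left := X.left
  right := X.right
  capL := X.capL
  capR := X.capR
  budget e := (X.budget e : ℝ≥0)

/-- The code of a capacity: `∞` is written as `0` and a finite `c` as `c + 1`. -/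
noncomputable def encodeCap (c : ℕ∞) : ℕ :=
  if c = ⊤ then 0 else c.toNat + 1

/-- The sequence of natural numbers that represents an input. -/
noncomputable def encode (X : PricingInput) : List ℕ :=
  [X.numL, X.numR, X.numE]
    ++ List.ofFn (fun u => encodeCap (X.capL u))
    ++ List.ofFn (fun v => encodeCap (X.capR v))
    ++ List.ofFn (fun e => (X.left e : ℕ))
    ++ List.ofFn (fun e => (X.right e : ℕ))
    ++ List.ofFn (fun e => (X.budget e).num)
    ++ List.ofFn (fun e => (X.budget e).den)

/-- The total bit length of an input. -/
noncomputable def size (X : PricingInput) : ℕ :=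
  RAM.bitLength X.encode

/-- The sequence `out` represents the solution `(p, F)`: first the numerator and the denominator of
the price of each item of `L`, then the indicator of `F`. -/
def Represents (X : PricingInput) (out : ℕ → ℕ) (p : Fin X.numL → ℝ≥0)
    (F : Finset (Fin X.numE)) : Prop :=
  (∀ u : Fin X.numL, out (2 * u + 1) ≠ 0 ∧
    p u = (out (2 * u) : ℝ≥0) / (out (2 * u + 1) : ℝ≥0)) ∧
  (∀ e : Fin X.numE, out (2 * X.numL + e) = if e ∈ F then 1 else 0)

/-- The sequence `out` represents a feasible solution such that no feasible solution has a revenue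
of more than `α` times its revenue. -/
def IsApproxSolution (α : ℝ≥0) (X : PricingInput) (out : ℕ → ℕ) : Prop :=
  ∃ (p : Fin X.numL → ℝ≥0) (F : Finset (Fin X.numE)),
    X.Represents out p F ∧ X.toInstance.Feasible p F ∧
    ∀ (p' : Fin X.numL → ℝ≥0) (F' : Finset (Fin X.numE)), X.toInstance.Feasible p' F' →
      X.toInstance.revenue p' F' ≤ α * X.toInstance.revenue p F

end PricingInput

/-! The factor two comes from a single charging argument in terms of slots. Split each vertex `v` of
`R` into slots, one per unit of capacity, so that a feasible solution places its customers in
distinct slots.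

Local optima (`revenue_add_le_of_swap_le`): fix solutions `F` at `p` and `F'` at `p'`, both placed
in slots. For an item `u`, switch its price to `p' u`, insert the customers of `F'` at `u`, and
evict from `F` the customers at `u` and those whose slots are claimed. Summed over all `u`, each
customer of `F` is evicted at most twice: once through its own item and once through its slot. Hence
the gains of the swaps sum to at least the revenue of `F'` minus twice that of `F`. If no swap gains
anything, this is the factor two. If each step is a best swap, it gains at least a `1 / |L|`
fraction of the remaining gap. After clearing denominators the revenues are integers below `2 ^ (3 *
N)`, so the gap vanishes after `|L| * 3 * N` steps (`le_two_mul_of_gap_decay`).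

The algorithm is not local search but one greedy pass over the items, for which no maximum revenue
at fixed prices has to be computed. It keeps the price currently paid in each slot. For an item,
each budget `q` of one of its customers is tried: customers are put into the cheapest slots
available at less than `q`, evicting the occupants, and the most profitable trial is kept. The
usable slot sets are bounded in total and at every vertex of `R`, so an exchange argument of matroid
type shows that the greedy choice is optimal (`Pending.assign`). Slot prices never decrease.
Therefore an item sold by a competing solution at price `q` in a slot set `C` brings at most the
gain of its own trial plus the final prices of the slots in `C`. The gains telescope to the total,
and the sets `C` of different items are disjoint, so the competitor earns at most twice the total
(`Competitive.step`, `Competitive.sum_le`).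

For the running time, the algorithm is written in a language of bounded loops. Loop bounds are cells
of the input, and a product may only have an input number, a constant or a truth value as its second
factor. Lengths of numbers then grow additively, and every such program runs in polynomial time
(`exists_time_bound`). -/

namespace RAM

/-! ### Loop programs -/

/-- Programs whose loops run a number of times that is read off a cell of the input bank. -/
inductive LoopProg
  | skip
  | assign (bank : ℕ) (address value : Expr)
  | seq (c d : LoopProg)
  | ite (test : Expr) (c d : LoopProg)
  | loop (counter bound : ℕ) (c : LoopProg)

namespace LoopProg

/-- The banks that a loop program may change. -/
def writes : LoopProg → List ℕ
  | skip => []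
  | assign b _ _ => [b]
  | seq c d => c.writes ++ d.writes
  | ite _ c d => c.writes ++ d.writes
  | loop x _ c => x :: c.writes

/-- Run the store transformer `f` for the counter values `0, …, n - 1` of the counter `x`. -/
def iter (x : ℕ) (f : Store → Store) (s : Store) : ℕ → Store
  | 0 => s.write x 0 0
  | k + 1 => (f (iter x f s k)).write x 0 (k + 1)

/-- The effect of a loop program on the store. -/
def run : LoopProg → Store → Store
  | skip, s => s
  | assign b a e, s => s.write b (a.eval s) (e.eval s)
  | seq c d, s => d.run (c.run s)
  | ite e c d, s => if e.eval s = 0 then d.run s else c.run s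
  | loop x j c, s => iter x c.run s (s 0 j)

/-- Loop programs as programs of the machine. -/
def compile : LoopProg → Prog
  | skip => .skip
  | assign b a e => .assign b a e
  | seq c d => .seq c.compile d.compile
  | ite e c d => .ite e c.compile d.compile
  | loop x j c => .seq (.assign x (.const 0) (.const 0))
      (.while (.op .lt (.read x (.const 0)) (.read 0 (.const j)))
        (.seq c.compile (.assign x (.const 0) (.op .add (.read x (.const 0)) (.const 1)))))

end LoopProg

/-- Expressions whose value is no longer than the numbers of the input. -/
def Expr.small : Expr → Bool
  | .const _ => true
  | .read b _ => b == 0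
  | .op .eq _ _ => true
  | .op .lt _ _ => true
  | .op _ _ _ => false

/-- Every product in the expression has a small second factor. -/
def Expr.tame : Expr → Bool
  | .const _ => true
  | .read _ a => a.tame
  | .op .mul a b => a.tame && b.tame && b.small
  | .op _ a b => a.tame && b.tame

/-- All expressions are tame, the input is not changed, loop bodies do not change the counter, and
loop bounds are among the first three cells of the input. -/
def LoopProg.tame : LoopProg → Bool
  | skip => true
  | assign b a e => b != 0 && a.tame && e.tame
  | seq c d => c.tame && d.tame
  | ite e c d => e.tame && c.tame && d.tame
  | loop x j c => x != 0 && decide (j < 3) && c.tame && !(c.writes.contains x)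

theorem Store.write_bank_ne (s : Store) {b b' : ℕ} (i x : ℕ) (h : b' ≠ b) :
    s.write b i x b' = s b' := by
  simp [Store.write, Function.update_of_ne h]

theorem Store.write_bank (s : Store) (b i x : ℕ) :
    s.write b i x b = Function.update (s b) i x := by
  simp [Store.write]

theorem Store.write_apply (s : Store) (b i x b' i' : ℕ) :
    s.write b i x b' i' = if b' = b ∧ i' = i then x else s b' i' := by
  by_cases h : b' = b
  · subst h
    rw [Store.write_bank, Function.update_apply]
    simp
  · simp [Store.write_bank_ne, h]

namespace LoopProg

/-- A bank that is not written keeps its content. -/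
theorem run_frame (c : LoopProg) (s : Store) (b : ℕ) (hb : b ∉ c.writes) : c.run s b = s b := by
  induction c generalizing s with
  | skip => rfl
  | assign b' a e =>
    simp only [writes, List.mem_singleton] at hb
    exact Store.write_bank_ne _ _ _ hb
  | seq c d ihc ihd =>
    simp only [writes, List.mem_append, not_or] at hb
    simp only [run]
    rw [ihd _ hb.2, ihc _ hb.1]
  | ite e c d ihc ihd =>
    simp only [writes, List.mem_append, not_or] at hb
    simp only [run]
    split_ifs
    exacts [ihd _ hb.2, ihc _ hb.1]
  | loop x j c ih =>
    simp only [writes, List.mem_cons, not_or] at hb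
    simp only [run]
    generalize s 0 j = n
    induction n with
    | zero => exact Store.write_bank_ne _ _ _ hb.1
    | succ k ihk => rw [iter, Store.write_bank_ne _ _ _ hb.1, ih _ hb.2, ihk]

theorem iter_frame (x : ℕ) (c : LoopProg) (s : Store) (n b : ℕ) (hx : b ≠ x)
    (hb : b ∉ c.writes) : iter x c.run s n b = s b := by
  induction n with
  | zero => exact Store.write_bank_ne _ _ _ hx
  | succ k ihk => rw [iter, Store.write_bank_ne _ _ _ hx, run_frame _ _ _ hb, ihk]

theorem iter_counter (x : ℕ) (f : Store → Store) (s : Store) (n : ℕ) :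
    iter x f s n x 0 = n := by
  cases n <;> simp [iter, Store.write_bank]

/-- The invariant rule for loops. -/
theorem run_loop_induction {x j : ℕ} {c : LoopProg} {s : Store} (I : ℕ → Store → Prop)
    (h0 : I 0 (s.write x 0 0))
    (hstep : ∀ k < s 0 j, ∀ s' : Store, s' x 0 = k →
      (∀ b, b ≠ x → b ∉ c.writes → s' b = s b) → I k s' →
        I (k + 1) ((c.run s').write x 0 (k + 1))) :
    I (s 0 j) ((loop x j c).run s) := by
  have : ∀ n ≤ s 0 j, I n (iter x c.run s n) := by
    intro n hn
    induction n with
    | zero => exact h0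
    | succ k ih =>
      exact hstep k hn _ (iter_counter ..) (fun b h h' => iter_frame _ _ _ _ _ h h') (ih (by omega))
  exact this _ le_rfl

end LoopProg

/-! ### Lengths of numbers and running time of tame loop programs -/

/-- All numbers of the input have length at most `N`, the loop bounds have value at most `N`, and
all numbers of the store have length at most `K`. -/
structure Store.Bounded (s : Store) (N K : ℕ) : Prop where
  input : ∀ i, (s 0 i).size ≤ N
  bound : ∀ j < 3, s 0 j ≤ N
  all : ∀ b i, (s b i).size ≤ K

theorem size_add_le (a b : ℕ) : (a + b).size ≤ max a.size b.size + 1 := by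
  rw [Nat.size_le, pow_succ]
  have ha : a < 2 ^ (max a.size b.size) :=
    (Nat.lt_size_self a).trans_le (Nat.pow_le_pow_right two_pos (le_max_left _ _))
  have hb : b < 2 ^ (max a.size b.size) :=
    (Nat.lt_size_self b).trans_le (Nat.pow_le_pow_right two_pos (le_max_right _ _))
  omega

theorem size_mul_le (a b : ℕ) : (a * b).size ≤ a.size + b.size := by
  rw [Nat.size_le, pow_add]
  exact Nat.mul_lt_mul'' (Nat.lt_size_self a) (Nat.lt_size_self b)

theorem Op.size_eval_le {o : Op} (ho : o ≠ .mul) (a b : ℕ) :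
    (o.eval a b).size ≤ max a.size b.size + 1 := by
  cases o with
  | mul => exact absurd rfl ho
  | add => exact size_add_le a b
  | sub => exact (Nat.size_le_size (Nat.sub_le a b)).trans (by omega)
  | div => exact (Nat.size_le_size (Nat.div_le_self a b)).trans (by omega)
  | eq => 
    simp only [Op.eval]
    split_ifs <;> simp
  | lt =>
    simp only [Op.eval]
    split_ifs <;> simp

/-- Growth of the lengths of numbers by evaluation of an expression. -/
def Expr.growth : Expr → ℕ
  | .const n => n.size
  | .read _ _ => 1
  | .op _ a b => a.growth + b.growth + 1

theorem Expr.size_eval_small {s : Store} {N K : ℕ} (hs : s.Bounded N K) (e : Expr)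
    (he : e.small) : (e.eval s).size ≤ e.growth * (N + 1) := by
  cases e with
  | const n => exact Nat.le_mul_of_pos_right _ (by omega)
  | read b a =>
    simp only [Expr.small, beq_iff_eq] at he
    subst he
    have := hs.input (a.eval s)
    simp only [Expr.eval, Expr.growth]
    omega
  | op o a b =>
    have key : ∀ x, x ≤ 1 → Nat.size x ≤ (Expr.op o a b).growth * (N + 1) := by
      intro x hx
      have h1 : Nat.size x ≤ 1 := by
        rw [Nat.size_le]
        omega
      refine h1.trans (Nat.succ_le_of_lt (Nat.mul_pos ?_ (by omega)))
      simp [Expr.growth]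
    cases o with
    | eq => exact key _ (by simp only [Expr.eval, Op.eval]; split_ifs <;> omega)
    | lt => exact key _ (by simp only [Expr.eval, Op.eval]; split_ifs <;> omega)
    | _ => simp [Expr.small] at he

/-- Addition costs one bit, and a product adds the length of its second factor, which
`Expr.size_eval_small` bounds in terms of the input alone. Thus `K` enters with coefficient one. A
coefficient of two would let lengths explode when the expression is evaluated inside a loop. -/
theorem Expr.size_eval_le {s : Store} {N K : ℕ} (hs : s.Bounded N K) (e : Expr)
    (he : e.tame) : (e.eval s).size ≤ K + e.growth * (N + 1) := by
  induction e with
  | const n => exact (Nat.le_mul_of_pos_right _ (by omega)).trans (Nat.le_add_left _ _)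
  | read b a _ => exact (hs.all _ _).trans (Nat.le_add_right _ _)
  | op o a b iha ihb =>
    by_cases ho : o = .mul
    · subst ho
      simp only [Expr.tame, Bool.and_eq_true] at he
      have h1 := iha he.1.1
      have h2 := Expr.size_eval_small hs b he.2
      have h3 := size_mul_le (a.eval s) (b.eval s)
      simp only [Expr.eval, Op.eval, Expr.growth, add_mul]
      omega
    · have he' : a.tame ∧ b.tame := by
        cases o <;> simp_all [Expr.tame]
      have h1 := iha he'.1
      have h2 := ihb he'.2
      have h3 := Op.size_eval_le ho (a.eval s) (b.eval s)
      simp only [Expr.eval, Expr.growth, add_mul]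
      generalize a.growth * (N + 1) = x at *
      generalize b.growth * (N + 1) = y at *
      omega

theorem Expr.exists_cost_le (e : Expr) (he : e.tame) :
    ∃ C : ℕ, ∀ (N K : ℕ) (s : Store), s.Bounded N K → e.cost s ≤ C * (N + 1) * (K + 1) := by
  have hsize : ∀ (e : Expr), e.tame → ∀ (N K : ℕ) (s : Store), s.Bounded N K →
      (e.eval s).size ≤ (1 + e.growth) * ((N + 1) * (K + 1)) := by
    intro e he N K s hs
    refine (Expr.size_eval_le hs e he).trans ?_
    rw [add_mul, one_mul]
    refine add_le_add ?_ (Nat.mul_le_mul_left _ (Nat.le_mul_of_pos_right _ (by omega)))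
    nlinarith
  induction e with
  | const n =>
    refine ⟨1 + n.size, fun N K s _ => ?_⟩
    rw [mul_assoc]
    exact Nat.le_mul_of_pos_right _ (by positivity)
  | read b a ih =>
    have ha : a.tame := by simpa [Expr.tame] using he
    obtain ⟨C, hC⟩ := ih ha
    refine ⟨C + 1 + (1 + a.growth) + 1, fun N K s hs => ?_⟩
    have h1 := hC N K s hs
    have h2 := hsize a ha N K s hs
    have h3 := hs.all b (a.eval s)
    have h4 : 1 ≤ (N + 1) * (K + 1) := Nat.succ_le_of_lt (by positivity)
    have h5 : K ≤ (N + 1) * (K + 1) := by nlinarith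
    simp only [Expr.cost]
    rw [mul_assoc] at h1 ⊢
    generalize (N + 1) * (K + 1) = x at *
    simp only [add_mul, one_mul] at *
    omega
  | op o a b iha ihb =>
    have he' : a.tame ∧ b.tame := by
      cases o <;> simp_all [Expr.tame]
    obtain ⟨A, hA⟩ := iha he'.1
    obtain ⟨B, hB⟩ := ihb he'.2
    refine ⟨A + B + 1 + (1 + a.growth) + (1 + b.growth) + (1 + (Expr.op o a b).growth),
      fun N K s hs => ?_⟩
    have h1 := hA N K s hs
    have h2 := hB N K s hs
    have h3 := hsize a he'.1 N K s hs
    have h4 := hsize b he'.2 N K s hs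
    have h5 := hsize _ he N K s hs
    have h6 : 1 ≤ (N + 1) * (K + 1) := Nat.succ_le_of_lt (by positivity)
    simp only [Expr.cost]
    simp only [Expr.eval] at h5
    rw [mul_assoc] at h1 h2 ⊢
    generalize (N + 1) * (K + 1) = x at *
    simp only [add_mul, one_mul] at *
    omega

theorem Store.Bounded.write {s : Store} {N K K' : ℕ} (hs : s.Bounded N K) (hK : K ≤ K') {b : ℕ}
    (hb : b ≠ 0) (i x : ℕ) (hx : x.size ≤ K') : (s.write b i x).Bounded N K' where
  input j := by rw [Store.write_bank_ne _ _ _ hb.symm]; exact hs.input j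
  bound j hj := by rw [Store.write_bank_ne _ _ _ hb.symm]; exact hs.bound j hj
  all b' i' := by
    rw [Store.write_apply]
    split_ifs
    exacts [hx, (hs.all _ _).trans hK]

namespace LoopProg

/-- Tame loop programs run in polynomial time, and lengths of numbers grow by a polynomial in the
size of the input. -/
theorem exists_time_bound (c : LoopProg) (hc : c.tame) :
    ∃ T G : Polynomial ℕ, ∀ (N K : ℕ) (s : Store), s.Bounded N K →
      (c.run s).Bounded N (K + G.eval N) ∧
      ∃ t, Exec c.compile s t (c.run s) ∧ t ≤ T.eval N * (K + 1) := by
  induction c with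
  | skip =>
    refine ⟨1, 0, fun N K s hs => ⟨by simpa [run] using hs, 1, Exec.skip s, ?_⟩⟩
    simp
  | assign b a e =>
    simp only [tame, Bool.and_eq_true, bne_iff_ne, ne_eq] at hc
    obtain ⟨⟨hb, ha⟩, he⟩ := hc
    obtain ⟨A, hA⟩ := a.exists_cost_le ha
    obtain ⟨B, hB⟩ := e.exists_cost_le he
    refine ⟨Polynomial.C (A + B + 3 + a.growth + e.growth) * (Polynomial.X + 1),
      Polynomial.C e.growth * (Polynomial.X + 1), fun N K s hs => ⟨?_, _, Exec.assign _ _ _ _, ?_⟩⟩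
    · refine hs.write (Nat.le_add_right _ _) hb _ _ ?_
      simpa using e.size_eval_le hs he
    · have h1 := hA N K s hs
      have h2 := hB N K s hs
      have h3 := a.size_eval_le hs ha
      have h4 := e.size_eval_le hs he
      simp only [Polynomial.eval_mul, Polynomial.eval_C, Polynomial.eval_add, Polynomial.eval_X,
        Polynomial.eval_one]
      have h5 : 1 ≤ (N + 1) * (K + 1) := Nat.succ_le_of_lt (by positivity)
      have h6 : K ≤ (N + 1) * (K + 1) := by nlinarith
      have h7 : a.growth * (N + 1) ≤ a.growth * ((N + 1) * (K + 1)) :=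
        Nat.mul_le_mul_left _ (Nat.le_mul_of_pos_right _ (by omega))
      have h8 : e.growth * (N + 1) ≤ e.growth * ((N + 1) * (K + 1)) :=
        Nat.mul_le_mul_left _ (Nat.le_mul_of_pos_right _ (by omega))
      rw [mul_assoc] at h1 h2 ⊢
      generalize (N + 1) * (K + 1) = x at *
      simp only [add_mul] at *
      omega
  | seq c d ihc ihd =>
    simp only [tame, Bool.and_eq_true] at hc
    obtain ⟨T, G, h⟩ := ihc hc.1
    obtain ⟨T', G', h'⟩ := ihd hc.2
    refine ⟨T + T' * (G + 1), G + G', fun N K s hs => ?_⟩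
    obtain ⟨h1, t, h2, h3⟩ := h N K s hs
    obtain ⟨h1', t', h2', h3'⟩ := h' N _ _ h1
    refine ⟨by simpa [run, add_assoc] using h1', _, Exec.seq h2 h2', ?_⟩
    simp only [Polynomial.eval_mul, Polynomial.eval_add, Polynomial.eval_one]
    have : T'.eval N * (K + G.eval N + 1) ≤ T'.eval N * ((G.eval N + 1) * (K + 1)) :=
      Nat.mul_le_mul_left _ (by nlinarith [Nat.zero_le (K * G.eval N)])
    rw [add_mul, mul_assoc]
    omega
  | ite e c d ihc ihd =>
    simp only [tame, Bool.and_eq_true] at hc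
    obtain ⟨C, hC⟩ := e.exists_cost_le hc.1.1
    obtain ⟨T, G, h⟩ := ihc hc.1.2
    obtain ⟨T', G', h'⟩ := ihd hc.2
    refine ⟨Polynomial.C C * (Polynomial.X + 1) + 1 + T + T', G + G', fun N K s hs => ?_⟩
    have h0 := hC N K s hs
    simp only [Polynomial.eval_mul, Polynomial.eval_C, Polynomial.eval_add, Polynomial.eval_X,
      Polynomial.eval_one, add_mul, run]
    rw [← add_mul, ← add_mul, ← add_mul]
    have mono : ∀ {s' : Store} {K' K''}, K' ≤ K'' → s'.Bounded N K' → s'.Bounded N K'' :=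
      fun hK hb => ⟨hb.input, hb.bound, fun b i => (hb.all b i).trans hK⟩
    have e1 : (C * N + C * 1 + 1) * (K + 1) = C * (N + 1) * (K + 1) + (K + 1) := by ring
    by_cases he : e.eval s = 0
    · obtain ⟨h1, t, h2, h3⟩ := h' N K s hs
      rw [if_pos he]
      refine ⟨mono (by omega) h1, _, Exec.ite_false he h2, ?_⟩
      simp only [add_mul] at *
      omega
    · obtain ⟨h1, t, h2, h3⟩ := h N K s hs
      rw [if_neg he]
      refine ⟨mono (by omega) h1, _, Exec.ite_true he h2, ?_⟩
      simp only [add_mul] at *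
      omega
  | loop x j c ih =>
    simp only [tame, Bool.and_eq_true, bne_iff_ne, ne_eq, decide_eq_true_eq, Bool.not_eq_true',
      List.contains_eq_mem, decide_eq_false_iff_not] at hc
    obtain ⟨⟨⟨hx, hj⟩, hc⟩, hxc⟩ := hc
    -- The body leaves the input alone, so the loop bound, which the compiled program reads again in
    -- every round, stays fixed.
    have hc0 : 0 ∉ c.writes := by
      clear ih hxc
      induction c with
      | skip => simp [writes]
      | assign b a e =>
        simp only [tame, Bool.and_eq_true, bne_iff_ne, ne_eq] at hc
        simpa [writes] using fun h => hc.1.1 h.symm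
      | seq c d ihc ihd =>
        simp only [tame, Bool.and_eq_true] at hc
        simp [writes, ihc hc.1, ihd hc.2]
      | ite e c d ihc ihd =>
        simp only [tame, Bool.and_eq_true] at hc
        simp [writes, ihc hc.1.2, ihd hc.2]
      | loop x j c ih =>
        simp only [tame, Bool.and_eq_true, bne_iff_ne, ne_eq] at hc
        simpa [writes, ih hc.1.2] using fun h => hc.1.1.1 h.symm
    obtain ⟨T, G, h⟩ := ih hc
    set test : Expr := .op .lt (.read x (.const 0)) (.read 0 (.const j)) with htest
    set inc : Expr := .op .add (.read x (.const 0)) (.const 1) with hinc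
    obtain ⟨C, hC⟩ := test.exists_cost_le rfl
    obtain ⟨C', hC'⟩ := inc.exists_cost_le rfl
    -- `T₁` pays for test, body and increment of one round. `G₁` bounds the growth per round and has
    -- room for the counter, which is rewritten each time. `T₂` takes into account that the numbers
    -- met during the loop have length up to `K + G₁ * (N + 2)`.
    let T₁ : Polynomial ℕ := Polynomial.C (C + C' + 8) * (Polynomial.X + 1) + T
    let G₁ : Polynomial ℕ := G + Polynomial.X + 1
    let T₂ : Polynomial ℕ := T₁ * (G₁ * (Polynomial.X + 2) + 1)
    refine ⟨T₂ * (Polynomial.X + 1) + 10, G₁ * (Polynomial.X + 1), fun N K s hs => ?_⟩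
    have hG₁ : G₁.eval N = G.eval N + N + 1 := by simp [G₁]
    have hsN : s 0 j ≤ N := hs.bound j hj
    have hsize : ∀ {k}, k ≤ N → k.size ≤ N := fun {k} hk => by
      rw [Nat.size_le]
      exact (hk.trans_lt N.lt_two_pow_self)
    have hb : ∀ k ≤ s 0 j, (iter x c.run s k).Bounded N (K + G₁.eval N * (k + 1)) := by
      intro k hk
      induction k with
      | zero => exact hs.write (Nat.le_add_right _ _) hx _ _ (by simp)
      | succ k ihk =>
        refine (h N _ _ (ihk (by omega))).1.write ?_ hx _ _ ?_
        · rw [add_assoc, mul_add _ (k + 1) 1]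
          omega
        · have := hsize (hk.trans hsN)
          have h2 : N ≤ G₁.eval N * (k + 1 + 1) := by
            rw [hG₁]
            nlinarith [Nat.zero_le (G.eval N), Nat.zero_le (G.eval N * k), Nat.zero_le (N * k)]
          omega
    have hK : ∀ k ≤ s 0 j, G₁.eval N * (k + 1) ≤ G₁.eval N * (N + 1) := fun k hk =>
      Nat.mul_le_mul_left _ (by omega)
    have hb' : ∀ k ≤ s 0 j, (iter x c.run s k).Bounded N (K + G₁.eval N * (N + 1)) := fun k hk =>
      ⟨(hb k hk).input, (hb k hk).bound, fun b i => ((hb k hk).all b i).trans (by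
        have := hK k hk
        omega)⟩
    have h0 : ∀ k, iter x c.run s k 0 = s 0 := fun k => iter_frame _ _ _ _ _ (Ne.symm hx) hc0
    have heval : ∀ k, test.eval (iter x c.run s k) = if k < s 0 j then 1 else 0 := by
      intro k
      simp only [htest, Expr.eval, Op.eval, iter_counter, h0]
    have h2K : K + G₁.eval N * (N + 2) + 1 ≤ (G₁.eval N * (N + 2) + 1) * (K + 1) := by
      nlinarith [Nat.zero_le (G₁.eval N * (N + 2) * K)]
    -- Induction on the number `d` of rounds still to run, because an execution of `while` unfolds
    -- from its first round whereas `iter` is built up to its last.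
    have key : ∀ d k, k + d = s 0 j → ∃ t, Exec (.while test (.seq c.compile (.assign x (.const 0) inc)))
        (iter x c.run s k) t (iter x c.run s (s 0 j)) ∧ t ≤ T₂.eval N * (K + 1) * (d + 1) := by
      intro d
      induction d with
      | zero =>
        intro k hk
        have hk' : k = s 0 j := hk
        subst hk'
        refine ⟨_, Exec.while_false (by rw [heval]; simp), ?_⟩
        have h1 := hC _ _ _ (hb' _ le_rfl)
        simp only [T₂, T₁, Polynomial.eval_mul, Polynomial.eval_C, Polynomial.eval_add,
          Polynomial.eval_X, Polynomial.eval_ofNat, Polynomial.eval_one]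
        have h3 : K + G₁.eval N * (N + 1) + 1 ≤ (G₁.eval N * (N + 2) + 1) * (K + 1) := by
          nlinarith [Nat.zero_le (G₁.eval N)]
        generalize (G₁.eval N * (N + 2) + 1) = z at *
        have h4 : C * (N + 1) * (K + G₁.eval N * (N + 1) + 1) ≤ C * (N + 1) * (z * (K + 1)) :=
          Nat.mul_le_mul_left _ h3
        have h5 : ((C + C' + 8) * (N + 1) + T.eval N) * z * (K + 1) * (0 + 1) =
          C * (N + 1) * (z * (K + 1)) + (C' * (N + 1) + 8 * N + 7 + T.eval N) * (z * (K + 1)) +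
            z * (K + 1) := by ring
        have h6 : 0 ≤ (C' * (N + 1) + 8 * N + 7 + T.eval N) * (z * (K + 1)) := Nat.zero_le _
        omega
      | succ d ihd =>
        intro k hk
        obtain ⟨t, ht, htb⟩ := ihd (k + 1) (by omega)
        have hkb := hb' k (by omega)
        obtain ⟨h1, t', h2, h3⟩ := h _ _ _ hkb
        have hcx : c.run (iter x c.run s k) x 0 = k := by
          rw [run_frame _ _ _ hxc, iter_counter]
        have hinc' : inc.eval (c.run (iter x c.run s k)) = k + 1 := by
          simp only [hinc, Expr.eval, Op.eval, hcx]
        have hassign := Exec.assign (c.run (iter x c.run s k)) x (.const 0) inc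
        have hst : (c.run (iter x c.run s k)).write x
            ((Expr.const 0).eval (c.run (iter x c.run s k)))
            (inc.eval (c.run (iter x c.run s k))) = iter x c.run s (k + 1) := by
          rw [hinc']
          rfl
        rw [hst] at hassign
        refine ⟨_, Exec.while_true (by rw [heval]; simp; omega) (Exec.seq h2 hassign) ht, ?_⟩
        have c1 := hC _ _ _ hkb
        have c2 := hC' _ _ _ h1
        have c3 := hsize (k := k + 1) (by omega)
        simp only [T₂, T₁, Polynomial.eval_mul, Polynomial.eval_C, Polynomial.eval_add,
          Polynomial.eval_X, Polynomial.eval_ofNat, Polynomial.eval_one] at htb ⊢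
        have hGle : G.eval N ≤ G₁.eval N := by omega
        have e3 : K + G₁.eval N * (N + 1) + G.eval N + 1 ≤ (G₁.eval N * (N + 2) + 1) * (K + 1) := by
          refine le_trans ?_ h2K
          have : G₁.eval N * (N + 2) = G₁.eval N * (N + 1) + G₁.eval N := by ring
          omega
        simp only [Expr.cost, Expr.eval, Nat.size_zero]
        generalize (G₁.eval N * (N + 2) + 1) = z at *
        have e4 : K + G₁.eval N * (N + 1) + 1 ≤ z * (K + 1) := by omega
        have e5 : C * (N + 1) * (K + G₁.eval N * (N + 1) + 1) ≤ C * (N + 1) * (z * (K + 1)) :=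
          Nat.mul_le_mul_left _ e4
        have e6 : C' * (N + 1) * (K + G₁.eval N * (N + 1) + G.eval N + 1) ≤
          C' * (N + 1) * (z * (K + 1)) := Nat.mul_le_mul_left _ e3
        have e7 : T.eval N * (K + G₁.eval N * (N + 1) + 1) ≤ T.eval N * (z * (K + 1)) :=
          Nat.mul_le_mul_left _ e4
        have e8 : 1 ≤ z * (K + 1) := by omega
        have e9 : (N + 1) * 1 ≤ (N + 1) * (z * (K + 1)) := Nat.mul_le_mul_left _ e8
        rw [hinc']
        have e10 : ((C + C' + 8) * (N + 1) + T.eval N) * z * (K + 1) * (d + 1 + 1) =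
          ((C + C' + 8) * (N + 1) + T.eval N) * z * (K + 1) * (d + 1) +
          C * (N + 1) * (z * (K + 1)) + C' * (N + 1) * (z * (K + 1)) +
          8 * ((N + 1) * (z * (K + 1))) + T.eval N * (z * (K + 1)) := by ring
        rw [e10]
        omega
    obtain ⟨t, ht, htb⟩ := key (s 0 j) 0 (by omega)
    refine ⟨by simpa [run] using hb' _ le_rfl, _, Exec.seq (Exec.assign s x (.const 0) (.const 0)) ht, ?_⟩
    simp only [Expr.cost, Expr.eval, Nat.size_zero, Polynomial.eval_mul, Polynomial.eval_add,
      Polynomial.eval_X, Polynomial.eval_ofNat, Polynomial.eval_one]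
    have : T₂.eval N * (K + 1) * (s 0 j + 1) ≤ T₂.eval N * (K + 1) * (N + 1) :=
      Nat.mul_le_mul_left _ (by omega)
    have e1 : (T₂.eval N * (N + 1) + 10) * (K + 1) =
      T₂.eval N * (K + 1) * (N + 1) + 10 * K + 10 := by ring
    omega

end LoopProg

theorem size_le_bitLength {l : List ℕ} {x : ℕ} (hx : x ∈ l) : x.size + 1 ≤ bitLength l :=
  List.single_le_sum (by simp) _ (List.mem_map_of_mem hx)

theorem length_le_bitLength (l : List ℕ) : l.length ≤ bitLength l := by
  induction l with
  | nil => simp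
  | cons a l ih =>
    simp only [bitLength, List.map_cons, List.sum_cons, List.length_cons] at *
    omega

theorem size_initStore_le (l : List ℕ) (b i : ℕ) : (initStore l b i).size ≤ bitLength l := by
  simp only [initStore]
  split_ifs
  · rw [List.getD_eq_getElem?_getD]
    cases h : l[i]? with
    | none => simp
    | some y => exact (Nat.le_succ _).trans (size_le_bitLength (List.mem_of_getElem? h))
  · simp

/-- A tame loop program whose loop bounds are at most the size of the input solves a search problem
in polynomial time. -/
theorem PolyTimeSolvable.of_loopProg {X : Type*} {encode : X → List ℕ}
    {Good : X → (ℕ → ℕ) → Prop} (c : LoopProg) (hc : c.tame)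
    (hbound : ∀ x, ∀ j < 3, (encode x).getD j 0 ≤ bitLength (encode x))
    (hgood : ∀ x, Good x (c.run (initStore (encode x)) 1)) : PolyTimeSolvable encode Good := by
  obtain ⟨T, G, h⟩ := c.exists_time_bound hc
  refine ⟨c.compile, T * (Polynomial.X + 1), fun x => ?_⟩
  obtain ⟨-, t, h1, h2⟩ := h (bitLength (encode x)) (bitLength (encode x)) (initStore (encode x))
    ⟨fun i => size_initStore_le _ _ _, fun j hj => by simpa [initStore] using hbound x j hj,
      fun b i => size_initStore_le _ _ _⟩
  exact ⟨t, _, h1, by simpa using h2, hgood x⟩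

end RAM

/-! ### Slots -/

/-- If every fibre of `f` in `F` respects its capacity, then the elements of each fibre can be given
distinct slots below the capacity. -/
theorem exists_slots {E R : Type*} (F : Finset E) (f : E → R) (cap : R → ℕ∞)
    (h : ∀ v, Set.encard {e : E | e ∈ F ∧ f e = v} ≤ cap v) :
    ∃ i : E → ℕ, (∀ e ∈ F, (i e : ℕ∞) < cap (f e)) ∧
      ∀ e ∈ F, ∀ e' ∈ F, f e = f e' → i e = i e' → e = e' := by
  classical
  have key : ∀ v, ∃ g : E → ℕ, (∀ e ∈ F, f e = v → (g e : ℕ∞) < cap v) ∧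
      ∀ e ∈ F, ∀ e' ∈ F, f e = v → f e' = v → g e = g e' → e = e' := by
    intro v
    set G := F.filter fun e => f e = v with hG
    have hcard : (G.card : ℕ∞) ≤ cap v := by
      rw [← Set.encard_coe_eq_coe_finsetCard]
      convert h v using 2
      ext e
      simp [hG]
    refine ⟨fun e => if he : e ∈ G then G.equivFin ⟨e, he⟩ else 0, ?_, ?_⟩
    · intro e he hv
      have heG : e ∈ G := by simp [hG, he, hv]
      simp only [heG, dif_pos]
      exact lt_of_lt_of_le (by exact_mod_cast (G.equivFin ⟨e, heG⟩).2) hcard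
    · intro e he e' he' hv hv' hee
      have heG : e ∈ G := by simp [hG, he, hv]
      have heG' : e' ∈ G := by simp [hG, he', hv']
      simp only [heG, heG', dif_pos] at hee
      simpa using G.equivFin.injective (Fin.ext hee)
  choose g hg1 hg2 using key
  refine ⟨fun e => g (f e) e, fun e he => hg1 _ e he rfl, fun e he e' he' hv hee => ?_⟩
  refine hg2 (f e) e he e' he' rfl hv.symm ?_
  exact hee.trans (by rw [hv])

/-- A converse of `exists_slots`. -/
theorem encard_le_of_slots {E R : Type*} (F : Finset E) (f : E → R) (cap : R → ℕ∞) (i : E → ℕ)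
    (h1 : ∀ e ∈ F, (i e : ℕ∞) < cap (f e))
    (h2 : ∀ e ∈ F, ∀ e' ∈ F, f e = f e' → i e = i e' → e = e') (v : R) :
    Set.encard {e : E | e ∈ F ∧ f e = v} ≤ cap v := by
  have hinj : Set.InjOn i {e : E | e ∈ F ∧ f e = v} := fun e he e' he' hee =>
    h2 e he.1 e' he'.1 (he.2.trans he'.2.symm) hee
  rw [← hinj.encard_image]
  cases hc : cap v with
  | top => exact le_top
  | coe c =>
    have : i '' {e : E | e ∈ F ∧ f e = v} ⊆ (Finset.range c : Set ℕ) := by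
      rintro _ ⟨e, he, rfl⟩
      have := h1 e he.1
      rw [he.2, hc] at this
      simpa using this
    refine (Set.encard_le_encard this).trans ?_
    rw [Set.encard_coe_eq_coe_finsetCard, Finset.card_range]

/-! ### The exchange argument for single swaps -/

namespace PricingInstance

variable {L R E : Type*}

theorem feasible_empty (I : PricingInstance L R E) (p : L → ℝ≥0) : I.Feasible p ∅ := by
  simp [Feasible]

theorem revenue_le_val [Fintype E] (I : PricingInstance L R E) {p : L → ℝ≥0} {F : Finset E}
    (h : I.Feasible p F) : I.revenue p F ≤ I.val p := by
  classical
  exact Finset.le_sup (f := I.revenue p) (by simpa using h)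

theorem exists_revenue_eq_val [Fintype E] (I : PricingInstance L R E) (p : L → ℝ≥0) :
    ∃ F, I.Feasible p F ∧ I.revenue p F = I.val p := by
  classical
  obtain ⟨F, hF, h⟩ := Finset.exists_mem_eq_sup
    (Finset.univ.filter fun F : Finset E => I.Feasible p F)
    ⟨∅, by simpa using I.feasible_empty p⟩ (I.revenue p)
  exact ⟨F, by simpa using hF, h.symm⟩

/-- For a given set of served customers, prices may be raised to budgets. -/
theorem exists_budget_prices (I : PricingInstance L R E) {p : L → ℝ≥0} {F : Finset E}
    (h : I.Feasible p F) :
    ∃ q : L → ℝ≥0, I.Feasible q F ∧ I.revenue p F ≤ I.revenue q F ∧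
      ∀ e ∈ F, ∃ e' ∈ F, I.left e' = I.left e ∧ q (I.left e) = I.budget e' := by
  classical
  have key : ∀ u : L, ∃ x : ℝ≥0, ∀ e ∈ F, I.left e = u →
      x ≤ I.budget e ∧ p u ≤ x ∧ ∃ e' ∈ F, I.left e' = u ∧ x = I.budget e' := by
    intro u
    by_cases hne : (F.filter fun e => I.left e = u).Nonempty
    -- The poorest customer served at `u` sets the price, so nobody is lost.
    · obtain ⟨e₀, he₀, hmin⟩ := Finset.exists_min_image _ I.budget hne
      rw [Finset.mem_filter] at he₀
      refine ⟨I.budget e₀, fun e he heu => ⟨hmin e (by simp [he, heu]), ?_, e₀, he₀.1, he₀.2, rfl⟩⟩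
      rw [← he₀.2]
      exact h.1 e₀ he₀.1
    · refine ⟨0, fun e he heu => (hne ⟨e, by simp [he, heu]⟩).elim⟩
  choose q hq using key
  exact ⟨q, ⟨fun e he => (hq _ e he rfl).1, h.2⟩,
    Finset.sum_le_sum fun e he => (hq _ e he rfl).2.1, fun e he => (hq _ e he rfl).2.2⟩

/-- The exchange inequality of single-swap local search. -/
theorem revenue_add_le_of_swap_le [Fintype L] [Fintype E] (I : PricingInstance L R E)
    {p p' : L → ℝ≥0} {F F' : Finset E} (hF : I.Feasible p F) (hF' : I.Feasible p' F')
    (hp' : ∀ e ∈ F', p' (I.left e) ∈ I.priceSet (I.left e)) {M : ℝ≥0}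
    (hM : ∀ p'', I.IsSwap p p'' → I.val p'' ≤ M) :
    I.revenue p' F' + Fintype.card L * I.revenue p F ≤
      Fintype.card L * M + 2 * I.revenue p F := by
  classical
  obtain ⟨i, hi1, hi2⟩ := exists_slots F I.right I.capR hF.2.2
  obtain ⟨i', hi1', hi2'⟩ := exists_slots F' I.right I.capR hF'.2.2
  set A : L → Finset E := fun u => F'.filter fun e => I.left e = u with hA
  set B : L → Finset E := fun u => F.filter fun e => I.left e = u with hB
  -- `A u` enters, `B u` leaves because the price of `u` changes, and `C u` leaves because its slots
  -- are taken by `A u`.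
  set C : L → Finset E := fun u => F.filter fun e => ∃ e' ∈ F', I.left e' = u ∧
    I.right e = I.right e' ∧ i e = i' e' with hC
  have hstep : ∀ u, ∑ e ∈ A u, p' (I.left e) + I.revenue p F ≤
      M + (∑ e ∈ B u, p (I.left e) + ∑ e ∈ C u, p (I.left e)) := by
    intro u
    by_cases hne : (A u).Nonempty
    · obtain ⟨e₀, he₀⟩ := hne
      simp only [hA, Finset.mem_filter] at he₀
      set q := Function.update p u (p' u) with hq
      set G := A u ∪ (F \ (B u ∪ C u)) with hG
      have hqu : ∀ e ∈ A u, q (I.left e) = p' (I.left e) := by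
        intro e he
        simp only [hA, Finset.mem_filter] at he
        simp [hq, he.2]
      have hq' : ∀ e ∈ F \ (B u ∪ C u), q (I.left e) = p (I.left e) := by
        intro e he
        simp only [hB, hC, Finset.mem_sdiff, Finset.mem_union, Finset.mem_filter, not_or,
          not_and] at he
        rw [hq, Function.update_of_ne (he.2.1 he.1)]
      have hfeas : I.Feasible q G := by
        refine ⟨?_, ?_, ?_⟩
        · intro e he
          rcases Finset.mem_union.1 he with he | he
          · rw [hqu e he]
            exact hF'.1 e (Finset.mem_filter.1 he).1
          · rw [hq' e he]
            exact hF.1 e (Finset.mem_sdiff.1 he).1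
        -- Left capacities are immediate: at `u` only customers of `F'` remain, and at every other
        -- vertex only customers of `F`.
        · intro w
          by_cases hw : w = u
          · subst hw
            refine (Set.encard_le_encard ?_).trans (hF'.2.1 w)
            rintro e ⟨he, hew⟩
            rcases Finset.mem_union.1 he with he | he
            · exact ⟨(Finset.mem_filter.1 he).1, hew⟩
            · simp [hB, hew] at he
              exact (he.2.1 he.1).elim
          · refine (Set.encard_le_encard ?_).trans (hF.2.1 w)
            rintro e ⟨he, hew⟩
            rcases Finset.mem_union.1 he with he | he
            · exact (hw (hew.symm.trans (Finset.mem_filter.1 he).2)).elim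
            · exact ⟨(Finset.mem_sdiff.1 he).1, hew⟩
        -- Customers keep the slots they have in their own solution. A clash between the two
        -- solutions would put the customer of `F` into `C u`.
        · refine encard_le_of_slots G I.right I.capR
            (fun e => if I.left e = u then i' e else i e) ?_ ?_
          · intro e he
            rcases Finset.mem_union.1 he with he | he
            · simp only [hA, Finset.mem_filter] at he
              simpa only [he.2, if_true] using hi1' e he.1
            · simp only [hB, hC, Finset.mem_sdiff, Finset.mem_union, Finset.mem_filter, not_or,
                not_and] at he
              simpa only [he.2.1 he.1, if_false] using hi1 e he.1
          · have cross : ∀ e ∈ A u, ∀ e' ∈ F \ (B u ∪ C u), I.right e = I.right e' →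
                i' e = i e' → False := by
              intro e he e' he' hr hs
              simp only [hA, hB, hC, Finset.mem_sdiff, Finset.mem_union, Finset.mem_filter, not_or,
                not_and] at he he'
              exact he'.2.2 he'.1 ⟨e, he.1, he.2, hr.symm, hs.symm⟩
            have hl : ∀ e ∈ F \ (B u ∪ C u), I.left e ≠ u := by
              intro e he
              simp only [hB, hC, Finset.mem_sdiff, Finset.mem_union, Finset.mem_filter, not_or,
                not_and] at he
              exact he.2.1 he.1
            have hl' : ∀ e ∈ A u, I.left e = u := fun e he => (Finset.mem_filter.1 he).2
            intro e he e' he' hr hs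
            rcases Finset.mem_union.1 he with h | h <;> rcases Finset.mem_union.1 he' with h' | h'
            · rw [if_pos (hl' e h), if_pos (hl' e' h')] at hs
              exact hi2' e (Finset.mem_filter.1 h).1 e' (Finset.mem_filter.1 h').1 hr hs
            · rw [if_pos (hl' e h), if_neg (hl e' h')] at hs
              exact (cross e h e' h' hr hs).elim
            · rw [if_neg (hl e h), if_pos (hl' e' h')] at hs
              exact (cross e' h' e h hr.symm hs.symm).elim
            · rw [if_neg (hl e h), if_neg (hl e' h')] at hs
              exact hi2 e (Finset.mem_sdiff.1 h).1 e' (Finset.mem_sdiff.1 h').1 hr hs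
      have hdisj : Disjoint (A u) (F \ (B u ∪ C u)) := by
        rw [Finset.disjoint_left]
        intro e he he'
        simp only [hA, hB, hC, Finset.mem_sdiff, Finset.mem_union, Finset.mem_filter, not_or,
          not_and] at he he'
        exact he'.2.1 he'.1 he.2
      have hrev : I.revenue q G = ∑ e ∈ A u, p' (I.left e) +
          ∑ e ∈ F \ (B u ∪ C u), p (I.left e) := by
        rw [revenue, hG, Finset.sum_union hdisj, Finset.sum_congr rfl hqu, Finset.sum_congr rfl hq']
      have hle : I.revenue q G ≤ M :=
        (I.revenue_le_val hfeas).trans (hM q (Or.inr ⟨u, p' u, he₀.2 ▸ hp' e₀ he₀.1, hq⟩))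
      have hsplit : I.revenue p F = ∑ e ∈ F \ (B u ∪ C u), p (I.left e) +
          ∑ e ∈ B u ∪ C u, p (I.left e) :=
        (Finset.sum_sdiff (Finset.union_subset (Finset.filter_subset _ _)
          (Finset.filter_subset _ _))).symm
      have hunion : ∑ e ∈ B u ∪ C u, p (I.left e) ≤
          ∑ e ∈ B u, p (I.left e) + ∑ e ∈ C u, p (I.left e) := by
        rw [← Finset.sum_union_inter]
        exact le_self_add
      rw [hsplit, ← add_assoc, ← hrev]
      exact add_le_add hle hunion
    -- With no customer of `F'` at `u`, the price `p' u` need not be a budget; the unchanged pricing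
    -- serves as the swap.
    · rw [Finset.not_nonempty_iff_eq_empty.1 hne, Finset.sum_empty, zero_add]
      exact ((I.revenue_le_val hF).trans (hM p (Or.inl rfl))).trans le_self_add
  have hsum := Finset.sum_le_sum fun u (_ : u ∈ Finset.univ) => hstep u
  simp only [Finset.sum_add_distrib, Finset.sum_const, nsmul_eq_mul, Finset.card_univ] at hsum
  have hsA : ∑ u, ∑ e ∈ A u, p' (I.left e) = I.revenue p' F' := Finset.sum_fiberwise _ _ _
  have hsB : ∑ u, ∑ e ∈ B u, p (I.left e) = I.revenue p F := Finset.sum_fiberwise _ _ _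
  -- The sets `C u` are disjoint: the slot of a customer of `F` is held by at most one customer of
  -- `F'`, which determines `u`.
  have hsC : ∑ u, ∑ e ∈ C u, p (I.left e) ≤ I.revenue p F := by
    rw [← Finset.sum_biUnion]
    · refine Finset.sum_le_sum_of_subset ?_
      exact Finset.biUnion_subset.2 fun u _ => Finset.filter_subset _ _
    · intro u _ w _ huw
      rw [Function.onFun, Finset.disjoint_left]
      intro e he he'
      simp only [hC, Finset.mem_filter] at he he'
      obtain ⟨-, a, ha, rfl, har, has⟩ := he
      obtain ⟨-, b, hb, rfl, hbr, hbs⟩ := he'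
      exact huw (congrArg I.left (hi2' a ha b hb (har.symm.trans hbr) (has.symm.trans hbs)))
  rw [hsA, hsB] at hsum
  refine hsum.trans ?_
  rw [two_mul]
  gcongr

/-- With `M = val p` the `|L|`-fold terms on both sides of the exchange inequality cancel. -/
theorem LocallyOptimal.half_val_le [Finite L] [Fintype E] {I : PricingInstance L R E}
    {p : L → ℝ≥0} (hp : I.LocallyOptimal p) (p' : L → ℝ≥0) : I.val p' / 2 ≤ I.val p := by
  have := Fintype.ofFinite L
  obtain ⟨F, hF, hFv⟩ := I.exists_revenue_eq_val p
  obtain ⟨F', hF', hFv'⟩ := I.exists_revenue_eq_val p'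
  obtain ⟨q, hq, hle, hqP⟩ := I.exists_budget_prices hF'
  have h := I.revenue_add_le_of_swap_le hF hq (fun e he => by
    obtain ⟨e', -, h1, h2⟩ := hqP e he
    exact ⟨e', h1, h2.symm⟩) hp
  rw [hFv, add_comm] at h
  have h2 := le_of_add_le_add_left h
  rw [hFv'] at hle
  rw [div_le_iff₀ two_pos, mul_comm]
  exact hle.trans h2

theorem IsBudgetPricing.swap {I : PricingInstance L R E} {p p' : L → ℝ≥0}
    (hp : I.IsBudgetPricing p) (h : I.IsSwap p p') : I.IsBudgetPricing p' := by
  classical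
  rcases h with rfl | ⟨u, q, hq, rfl⟩
  · exact hp
  · intro w hw
    by_cases h : w = u
    · subst h
      simpa using hq
    · rw [Function.update_of_ne h]
      exact hp w hw

end PricingInstance

/-! ### The number of iterations of best-improvement search -/

/-- A sequence of integers whose gap to half of `o` shrinks by a constant fraction of `1 / n` in each
step closes the gap in `n * N` steps, if `o < 2 ^ N`. -/
theorem le_two_mul_of_gap_decay {n o N : ℕ} (ho : o < 2 ^ N) {x : ℕ → ℕ}
    (hmono : ∀ k, x k ≤ x (k + 1)) (h : ∀ k, o + n * x k ≤ n * x (k + 1) + 2 * x k) (k : ℕ)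
    (hk : n * N ≤ k) : o ≤ 2 * x k := by
  rcases Nat.eq_zero_or_pos n with rfl | hn
  · simpa using h k
  by_contra! hlt
  have hxm : Monotone x := monotone_nat_of_le_succ hmono
  have hnR : (0 : ℝ) < n := by exact_mod_cast hn
  have hn1 : (1 : ℝ) / n ≤ 1 := by
    rw [div_le_one hnR]
    exact_mod_cast hn
  have key : ∀ j ≤ k, (o : ℝ) - 2 * x j ≤ (1 - 1 / n) ^ j * o := by
    intro j hj
    induction j with
    | zero => simp
    | succ j ih =>
      have h1 := ih (by omega)
      have h2 : (o : ℝ) + n * x j ≤ n * x (j + 1) + 2 * x j := by exact_mod_cast h j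
      have h3 : 2 * (x j : ℝ) ≤ o := by
        have := hxm (show j ≤ k by omega)
        have : 2 * x j ≤ o := by omega
        exact_mod_cast this
      -- The recurrence would even allow the factor `1 - 2 / n`, but that is negative for `n = 1`.
      -- With `1 - 1 / n` the induction hypothesis can be multiplied by a nonnegative number.
      have h4 : (o : ℝ) - 2 * x (j + 1) ≤ (1 - 1 / n) * (o - 2 * x j) := by
        rw [sub_mul, one_mul, div_mul_eq_mul_div, one_mul, le_sub_iff_add_le, ← le_sub_iff_add_le',
          div_le_iff₀ hnR]
        nlinarith
      refine h4.trans ?_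
      rw [pow_succ', mul_assoc]
      exact mul_le_mul_of_nonneg_left h1 (by linarith)
  have h1 := key k le_rfl
  -- By integrality a positive gap is at least one, whereas the decay forces it below `exp (-N) *
  -- exp N = 1`.
  have h2 : (1 : ℝ) ≤ o - 2 * x k := by
    have : 2 * x k + 1 ≤ o := hlt
    have : (2 * x k + 1 : ℝ) ≤ o := by exact_mod_cast this
    linarith
  have h3 : (1 - 1 / (n : ℝ)) ^ k ≤ Real.exp (-N) := by
    calc (1 - 1 / (n : ℝ)) ^ k ≤ Real.exp (-(1 / n)) ^ k :=
          pow_le_pow_left₀ (by linarith) (Real.one_sub_le_exp_neg _) _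
      _ = Real.exp (-(k / n)) := by
          rw [← Real.exp_nat_mul]
          congr 1
          ring
      _ ≤ Real.exp (-N) := by
          refine Real.exp_le_exp.2 (neg_le_neg ?_)
          rw [le_div_iff₀ hnR, mul_comm]
          exact_mod_cast hk
  have h4 : (o : ℝ) < Real.exp N := by
    calc (o : ℝ) < 2 ^ N := by exact_mod_cast ho
      _ ≤ Real.exp 1 ^ N := pow_le_pow_left₀ (by norm_num) (by linarith [Real.add_one_le_exp 1]) _
      _ = Real.exp N := by rw [← Real.exp_nat_mul, mul_one]
  have h5 : (1 - 1 / (n : ℝ)) ^ k * o < 1 := by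
    calc (1 - 1 / (n : ℝ)) ^ k * o ≤ Real.exp (-N) * o :=
          mul_le_mul_of_nonneg_right h3 (Nat.cast_nonneg _)
      _ < Real.exp (-N) * Real.exp N := mul_lt_mul_of_pos_left h4 (Real.exp_pos _)
      _ = 1 := by rw [← Real.exp_add]; simp
  linarith

namespace PricingInput

/-- The common denominator of the budgets. -/
def commonDen (X : PricingInput) : ℕ := ∏ e, (X.budget e).den

/-- The budgets, scaled to natural numbers. -/
def scaledBudget (X : PricingInput) (e : Fin X.numE) : ℕ :=
  X.commonDen / (X.budget e).den * (X.budget e).num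

theorem commonDen_pos (X : PricingInput) : 0 < X.commonDen :=
  Finset.prod_pos fun e _ => (X.budget e).den_pos

theorem scaledBudget_cast (X : PricingInput) (e : Fin X.numE) :
    (X.scaledBudget e : ℝ≥0) = X.commonDen * X.toInstance.budget e := by
  have hdvd : (X.budget e).den ∣ X.commonDen := Finset.dvd_prod_of_mem _ (Finset.mem_univ e)
  have hne : ((X.budget e).den : ℝ≥0) ≠ 0 := by exact_mod_cast (X.budget e).den_ne_zero
  rw [scaledBudget, Nat.cast_mul, Nat.cast_div hdvd hne, toInstance]
  simp only
  rw [NNRat.cast_def]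
  field_simp

theorem bitLength_append (l l' : List ℕ) :
    RAM.bitLength (l ++ l') = RAM.bitLength l + RAM.bitLength l' := by
  simp [RAM.bitLength]

theorem numL_le_size (X : PricingInput) : X.numL ≤ X.size := by
  refine le_trans ?_ (RAM.length_le_bitLength _)
  simp only [encode, List.length_append, List.length_ofFn]
  omega

theorem numR_le_size (X : PricingInput) : X.numR ≤ X.size := by
  refine le_trans ?_ (RAM.length_le_bitLength _)
  simp only [encode, List.length_append, List.length_ofFn]
  omega

theorem numE_le_size (X : PricingInput) : X.numE ≤ X.size := by
  refine le_trans ?_ (RAM.length_le_bitLength _)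
  simp only [encode, List.length_append, List.length_ofFn]
  omega

/-- The product of the denominators is no longer than all of them written in sequence, and they are
a block of the encoding. -/
theorem commonDen_le (X : PricingInput) : X.commonDen ≤ 2 ^ X.size := by
  have h1 : X.commonDen ≤ 2 ^ (∑ e, (X.budget e).den.size) := by
    rw [← Finset.prod_pow_eq_pow_sum]
    exact Finset.prod_le_prod' fun e _ => (Nat.lt_size_self _).le
  refine h1.trans (Nat.pow_le_pow_right two_pos ?_)
  rw [size, encode, bitLength_append]
  refine le_trans ?_ (Nat.le_add_left _ _)
  rw [RAM.bitLength, List.map_ofFn, List.sum_ofFn]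
  exact Finset.sum_le_sum fun e _ => Nat.le_succ _

theorem scaledBudget_le (X : PricingInput) (e : Fin X.numE) :
    X.scaledBudget e ≤ 2 ^ X.size * 2 ^ X.size := by
  refine Nat.mul_le_mul ((Nat.div_le_self _ _).trans X.commonDen_le) ?_
  refine (Nat.lt_size_self _).le.trans (Nat.pow_le_pow_right two_pos ?_)
  refine (Nat.le_succ _).trans (RAM.size_le_bitLength (l := X.encode) ?_)
  simp only [encode, List.mem_append, List.mem_ofFn]
  exact Or.inl (Or.inr ⟨e, rfl⟩)

/-- Scaled revenues of prices that are budgets are natural numbers. -/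
theorem exists_scaled_revenue (X : PricingInput) {q : Fin X.numL → ℝ≥0} {F : Finset (Fin X.numE)}
    (h : ∀ e ∈ F, ∃ e', q (X.left e) = X.toInstance.budget e') :
    ∃ r : ℕ, (r : ℝ≥0) = X.commonDen * X.toInstance.revenue q F ∧ r < 2 ^ (3 * X.size) := by
  -- Outside `F` any edge will do; `e` itself makes the choice function total.
  have h' : ∀ e, ∃ e', e ∈ F → q (X.left e) = X.toInstance.budget e' := fun e => by
    by_cases he : e ∈ F
    · obtain ⟨e', he'⟩ := h e he
      exact ⟨e', fun _ => he'⟩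
    · exact ⟨e, fun h => (he h).elim⟩
  choose f hf using h'
  refine ⟨∑ e ∈ F, X.scaledBudget (f e), ?_, ?_⟩
  · rw [Nat.cast_sum, PricingInstance.revenue, Finset.mul_sum]
    refine Finset.sum_congr rfl fun e he => ?_
    rw [scaledBudget_cast, ← hf e he]
    rfl
  · have h1 : ∑ e ∈ F, X.scaledBudget (f e) ≤ X.numE * (2 ^ X.size * 2 ^ X.size) := by
      refine (Finset.sum_le_card_nsmul _ _ _ fun e _ => X.scaledBudget_le (f e)).trans ?_
      rw [smul_eq_mul]
      exact Nat.mul_le_mul_right _ ((Finset.card_le_univ F).trans (by simp))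
    refine h1.trans_lt ?_
    have h2 : X.numE < 2 ^ X.size := X.numE_le_size.trans_lt Nat.lt_two_pow_self
    -- One factor each for the number of edges, the common denominator and a numerator.
    have h3 : 2 ^ (3 * X.size) = 2 ^ X.size * (2 ^ X.size * 2 ^ X.size) := by
      rw [← pow_add, ← pow_add]
      congr 1
      ring
    rw [h3]
    exact Nat.mul_lt_mul_of_pos_right h2 (by positivity)

/-- Local search by best swaps reaches half of the optimum in polynomially many steps. -/
theorem half_val_le_of_isBestSwap (X : PricingInput) (p : ℕ → Fin X.numL → ℝ≥0)
    (h0 : X.toInstance.IsBudgetPricing (p 0))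
    (hp : ∀ k, X.toInstance.IsBestSwap (p k) (p (k + 1))) (k : ℕ)
    (hk : X.numL * (3 * X.size) ≤ k) (p' : Fin X.numL → ℝ≥0) :
    X.toInstance.val p' / 2 ≤ X.toInstance.val (p k) := by
  set I := X.toInstance with hI
  have hD : (0 : ℝ≥0) < X.commonDen := by exact_mod_cast X.commonDen_pos
  have hb : ∀ k, I.IsBudgetPricing (p k) := fun k => by
    induction k with
    | zero => exact h0
    | succ k ih => exact ih.swap (hp k).1
  have hx : ∀ k, ∃ r : ℕ, (r : ℝ≥0) = X.commonDen * I.val (p k) := fun k => by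
    obtain ⟨F, -, hFv⟩ := I.exists_revenue_eq_val (p k)
    obtain ⟨r, hr, -⟩ := X.exists_scaled_revenue (q := p k) (F := F) fun e _ => by
      obtain ⟨e', -, he'⟩ := hb k (X.left e) ⟨_, e, rfl, rfl⟩
      exact ⟨e', he'.symm⟩
    exact ⟨r, by rw [hr, hFv]⟩
  choose x hx using hx
  obtain ⟨F', hF', hFv'⟩ := I.exists_revenue_eq_val p'
  obtain ⟨q, hq, hle, hqP⟩ := I.exists_budget_prices hF'
  obtain ⟨o, ho, ho2⟩ := X.exists_scaled_revenue (q := q) (F := F') fun e he => by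
    obtain ⟨e', -, -, h⟩ := hqP e he
    exact ⟨e', h⟩
  have main : o ≤ 2 * x k := by
    refine le_two_mul_of_gap_decay ho2 (fun k => ?_) (fun k => ?_) k hk
    · have : (x k : ℝ≥0) ≤ x (k + 1) := by
        rw [hx, hx]
        exact mul_le_mul_of_nonneg_left ((hp k).2 _ (Or.inl rfl)) hD.le
      exact_mod_cast this
    · obtain ⟨F, hF, hFv⟩ := I.exists_revenue_eq_val (p k)
      have h := I.revenue_add_le_of_swap_le hF hq (fun e he => by
        obtain ⟨e', -, h1, h2⟩ := hqP e he
        exact ⟨e', h1, h2.symm⟩) (hp k).2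
      rw [hFv, Fintype.card_fin] at h
      have h' := mul_le_mul_of_nonneg_left h hD.le
      have : (o : ℝ≥0) + X.numL * x k ≤ X.numL * x (k + 1) + 2 * x k := by
        rw [hx, hx, ho]
        calc _ = X.commonDen * (I.revenue q F' + X.numL * I.val (p k)) := by ring
          _ ≤ _ := h'
          _ = _ := by ring
      exact_mod_cast this
  have main' : (o : ℝ≥0) ≤ 2 * x k := by exact_mod_cast main
  rw [ho, hx] at main'
  have h2 : I.revenue q F' ≤ 2 * I.val (p k) := by
    refine le_of_mul_le_mul_left ?_ hD
    calc _ ≤ _ := main'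
      _ = _ := by ring
  rw [div_le_iff₀ two_pos, mul_comm, ← hFv']
  exact hle.trans h2

end PricingInput

/-! ### Filling slots greedily -/

/-- A pricing instance with integral budgets and finite capacities. The edges at a vertex of `R`
serve as its slots. -/
structure SlotData where
  m : ℕ
  left : ℕ → ℕ
  right : ℕ → ℕ
  budget : ℕ → ℕ
  capL : ℕ → ℕ
  capR : ℕ → ℕ

namespace SlotData

open Finset

variable (d : SlotData)

/-- The slots with the first `capR v` numbers at each `v` may be used. -/
def Valid (s : ℕ) : Prop := #{i ∈ range s | d.right i = d.right s} < d.capR (d.right s)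

/-- The customers for `u` at `v` that can afford the price `q`. -/
def eligible (u q v : ℕ) : Finset ℕ :=
  {e ∈ range d.m | d.left e = u ∧ q ≤ d.budget e ∧ d.right e = v}

/-- `C` is a set of slots that can be used by customers of `u` if the price of `u` is `q`. -/
structure Admissible (u q : ℕ) (C : Finset ℕ) : Prop where
  sub : C ⊆ range d.m
  valid : ∀ s ∈ C, d.Valid s
  card : #C ≤ d.capL u
  count : ∀ v, #{s ∈ C | d.right s = v} ≤ #(d.eligible u q v)

/-- Slot prices `W` and occupants `S` are changed to `W'` and `S'` by assigning the customers in `A`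
for `u` at price `q` to the slots in `T`. Occupants are numbered from `1`. -/
structure Fill (u q : ℕ) (W S : ℕ → ℕ) (T A : Finset ℕ) (W' S' : ℕ → ℕ) : Prop where
  sub : T ⊆ range d.m
  valid : ∀ s ∈ T, d.Valid s
  le : ∀ s ∈ T, W s ≤ q
  price : ∀ s < d.m, W' s = if s ∈ T then q else W s
  old : ∀ s < d.m, s ∉ T → S' s = S s
  new : ∀ s ∈ T, ∃ e ∈ A, S' s = e + 1 ∧ d.right e = d.right s
  inj : Set.InjOn S' T
  customer : ∀ e ∈ A, e < d.m ∧ d.left e = u ∧ q ≤ d.budget e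
  count : ∀ v, #{e ∈ A | d.right e = v} = #{s ∈ T | d.right s = v}
  card : #T ≤ d.capL u

/-- The total price of the slots. -/
def total (W : ℕ → ℕ) : ℕ := ∑ s ∈ range d.m, W s

/-- The gain of no admissible set of slots exceeds the gain of passing from `W` to `W'`. -/
def Best (u q : ℕ) (W W' : ℕ → ℕ) : Prop :=
  ∀ C, d.Admissible u q C → d.total W + ∑ s ∈ C, (q - W s) ≤ d.total W'

/-- Every admissible set of slots can be exchanged for a set that extends the filled slots `T` and has
no smaller gain. -/
def Pending (u q : ℕ) (W : ℕ → ℕ) (T A : Finset ℕ) (W' : ℕ → ℕ) : Prop :=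
  ∀ C, d.Admissible u q C → ∃ C' ⊆ range d.m, (∀ s ∈ C', d.Valid s) ∧ Disjoint C' T ∧
    #C' + #T ≤ d.capL u ∧
    (∀ v, #{s ∈ C' | d.right s = v} + #{e ∈ A | d.right e = v} ≤ #(d.eligible u q v)) ∧
    d.total W + ∑ s ∈ C, (q - W s) ≤ d.total W' + ∑ s ∈ C', (q - W s)

/-- The unused customer `e` can be assigned to the slot `s`. -/
structure Pair (u q : ℕ) (A : Finset ℕ) (e s : ℕ) : Prop where
  lt_e : e < d.m
  lt_s : s < d.m
  left : d.left e = u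
  le : q ≤ d.budget e
  unused : e ∉ A
  valid : d.Valid s
  right : d.right e = d.right s

variable {d} {u q : ℕ} {W S W' S' : ℕ → ℕ} {T A : Finset ℕ}

theorem total_congr (h : ∀ s < d.m, W s = W' s) : d.total W = d.total W' :=
  sum_congr rfl fun s hs => h s (mem_range.1 hs)

theorem total_update {s : ℕ} (hs : s < d.m) (x : ℕ) :
    d.total (Function.update W s x) + W s = d.total W + x := by
  have hs' : s ∈ range d.m := mem_range.2 hs
  rw [total, total, sum_update_of_mem hs', ← sum_sdiff (singleton_subset_iff.2 hs') (f := W),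
    sum_singleton]
  ring

theorem Fill.refl (hW : ∀ s < d.m, W' s = W s) (hS : ∀ s < d.m, S' s = S s) :
    d.Fill u q W S ∅ ∅ W' S' := by
  constructor <;> simp_all

theorem Pending.refl (hW : ∀ s < d.m, W' s = W s) : d.Pending u q W ∅ ∅ W' := by
  intro C hC
  refine ⟨C, hC.sub, hC.valid, by simp, by simpa using hC.card, fun v => by simpa using hC.count v,
    ?_⟩
  rw [total_congr hW]

theorem Fill.le_new (h : d.Fill u q W S T A W' S') {s : ℕ} (hs : s < d.m) : W s ≤ W' s := by
  rw [h.price s hs]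
  split_ifs with hT
  exacts [h.le s hT, le_rfl]

theorem Fill.notMem_of_lt (h : d.Fill u q W S T A W' S') {s : ℕ} (hs : s < d.m) (hlt : W' s < q) :
    s ∉ T := by
  intro hT
  rw [h.price s hs, if_pos hT] at hlt
  exact lt_irrefl _ hlt

/-- Filled slots cost exactly `q`, so the strict bound on the price of `s` makes `s` a fresh slot.
Since `e` is unused, the occupants remain distinct. -/
theorem Fill.assign (h : d.Fill u q W S T A W' S') {e s : ℕ} (hp : d.Pair u q A e s)
    (hlt : W' s < q) (hcard : #T < d.capL u) :
    d.Fill u q W S (insert s T) (insert e A) (Function.update W' s q)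
      (Function.update S' s (e + 1)) := by
  have hsT := h.notMem_of_lt hp.lt_s hlt
  refine ⟨?_, ?_, ?_, ?_, ?_, ?_, ?_, ?_, ?_, ?_⟩
  · exact insert_subset (mem_range.2 hp.lt_s) h.sub
  · intro t ht
    rcases mem_insert.1 ht with rfl | ht
    exacts [hp.valid, h.valid t ht]
  · intro t ht
    rcases mem_insert.1 ht with rfl | ht
    · exact (h.le_new hp.lt_s).trans hlt.le
    · exact h.le t ht
  · intro t ht
    by_cases hts : t = s
    · subst hts
      simp
    · rw [Function.update_of_ne hts, h.price t ht]
      simp [hts]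
  · intro t ht htT
    rw [mem_insert, not_or] at htT
    rw [Function.update_of_ne htT.1, h.old t ht htT.2]
  · intro t ht
    by_cases hts : t = s
    · subst hts
      exact ⟨e, mem_insert_self _ _, by simp, hp.right⟩
    · obtain ⟨e', he', h1, h2⟩ := h.new t ((mem_insert.1 ht).resolve_left hts)
      exact ⟨e', mem_insert_of_mem he', by rw [Function.update_of_ne hts, h1], h2⟩
  · have hne : ∀ t ∈ T, S' t ≠ e + 1 := by
      intro t ht hte
      obtain ⟨e', he', h1, -⟩ := h.new t ht
      have : e' = e := by omega
      exact hp.unused (this ▸ he')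
    intro t ht t' ht' htt
    rw [mem_coe, mem_insert] at ht ht'
    by_cases hts : t = s <;> by_cases hts' : t' = s
    · rw [hts, hts']
    · rw [hts, Function.update_self, Function.update_of_ne hts'] at htt
      exact (hne t' (ht'.resolve_left hts') htt.symm).elim
    · rw [hts', Function.update_self, Function.update_of_ne hts] at htt
      exact (hne t (ht.resolve_left hts) htt).elim
    · rw [Function.update_of_ne hts, Function.update_of_ne hts'] at htt
      exact h.inj (ht.resolve_left hts) (ht'.resolve_left hts') htt
  · intro e' he'
    rcases mem_insert.1 he' with rfl | he'
    exacts [⟨hp.lt_e, hp.left, hp.le⟩, h.customer e' he']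
  · intro v
    rw [filter_insert, filter_insert, hp.right]
    split_ifs
    · rw [card_insert_of_notMem (by simp [hp.unused]), card_insert_of_notMem (by simp [hsT]), h.count]
    · exact h.count v
  · rw [card_insert_of_notMem hsT]
    exact hcard

theorem Fill.filter_subset_eligible (h : d.Fill u q W S T A W' S') (v : ℕ) :
    {e ∈ A | d.right e = v} ⊆ d.eligible u q v := by
  intro e he
  rw [mem_filter] at he
  obtain ⟨h1, h2, h3⟩ := h.customer e he.1
  simp [eligible, h1, h2, h3, he.2]

/-- If a set of slots can still be used, then each of its elements can be assigned to an unused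
customer. -/
theorem exists_pair {C : Finset ℕ} (hC : C ⊆ range d.m)
    (hvalid : ∀ s ∈ C, d.Valid s)
    (hcount : ∀ v, #{s ∈ C | d.right s = v} + #{e ∈ A | d.right e = v} ≤ #(d.eligible u q v))
    {s : ℕ} (hs : s ∈ C) : ∃ e, d.Pair u q A e s := by
  have h1 : 0 < #{t ∈ C | d.right t = d.right s} := card_pos.2 ⟨s, by simp [hs]⟩
  have h2 := hcount (d.right s)
  obtain ⟨e, he, heA⟩ := exists_mem_notMem_of_card_lt_card
    (s := {e ∈ A | d.right e = d.right s}) (t := d.eligible u q (d.right s)) (by omega)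
  simp only [eligible, mem_filter, mem_range] at he heA
  exact ⟨e, he.1, mem_range.1 (hC hs), he.2.1, he.2.2.1, fun h => heA ⟨h, he.2.2.2⟩, hvalid s hs,
    he.2.2.2⟩

/-- The exchange step behind the greedy choice. To make room for `s`, the witness `C'` gives up one
slot `x`: `s` itself if present, otherwise a slot at the same vertex, otherwise any slot. As `s` is
a cheapest assignable slot, the gain given up is at most the gain of filling `s`. -/
theorem Pending.assign (hpend : d.Pending u q W T A W') (h : d.Fill u q W S T A W' S') {e s : ℕ}
    (hp : d.Pair u q A e s) (hlt : W' s < q) (hcard : #T < d.capL u)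
    (hmin : ∀ e' s', d.Pair u q A e' s' → W' s ≤ W' s') :
    d.Pending u q W (insert s T) (insert e A) (Function.update W' s q) := by
  have hsT := h.notMem_of_lt hp.lt_s hlt
  intro C hC
  obtain ⟨C', hsub, hvalid, hdisj, hc, hcount, hsum⟩ := hpend C hC
  have htot := total_update (W := W') hp.lt_s q
  -- The customer `e` is eligible and unused. This gives the count at the vertex of `s` when `C'`
  -- has no slot there to give up.
  have helig : #{e ∈ A | d.right e = d.right s} < #(d.eligible u q (d.right s)) := by
    refine card_lt_card ⟨h.filter_subset_eligible _, fun hsub => hp.unused ?_⟩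
    have : e ∈ d.eligible u q (d.right s) := by
      simp [eligible, hp.lt_e, hp.left, hp.le, hp.right]
    exact (mem_filter.1 (hsub this)).1
  have hWs : W' s = W s := by rw [h.price s hp.lt_s, if_neg hsT]
  have hcase : C' = ∅ ∨ ∃ x ∈ C', x = s ∨ s ∉ C' ∧
      (d.right x = d.right s ∨ ∀ y ∈ C', d.right y ≠ d.right s) := by
    rcases C'.eq_empty_or_nonempty with h0 | ⟨y, hy⟩
    · exact Or.inl h0
    · right
      by_cases hs : s ∈ C'
      · exact ⟨s, hs, Or.inl rfl⟩
      · by_cases hx : ∃ x ∈ C', d.right x = d.right s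
        · obtain ⟨x, hx, hxs⟩ := hx
          exact ⟨x, hx, Or.inr ⟨hs, Or.inl hxs⟩⟩
        · push Not at hx
          exact ⟨y, hy, Or.inr ⟨hs, Or.inr hx⟩⟩
  have hAcount : ∀ v, #{e' ∈ insert e A | d.right e' = v} =
      #{e' ∈ A | d.right e' = v} + if v = d.right s then 1 else 0 := by
    intro v
    rw [filter_insert, hp.right]
    by_cases hv : d.right s = v
    · rw [if_pos hv, if_pos hv.symm, card_insert_of_notMem (by simp [hp.unused])]
    · rw [if_neg hv, if_neg (Ne.symm hv)]
      rfl
  rcases hcase with rfl | ⟨x, hx, hxs⟩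
  · refine ⟨∅, by simp, by simp, by simp, ?_, fun v => ?_, ?_⟩
    · rw [card_insert_of_notMem hsT, card_empty]
      omega
    · rw [hAcount]
      have := hcount v
      simp only [filter_empty, card_empty, zero_add] at this ⊢
      split_ifs with hv
      · subst hv
        omega
      · exact this
    · simp only [sum_empty, add_zero] at hsum ⊢
      omega
  · have hxT : x ∉ T := fun hT => disjoint_left.1 hdisj hx hT
    have hcx := card_erase_add_one hx
    refine ⟨C'.erase x, (erase_subset _ _).trans hsub, fun t ht => hvalid t (mem_of_mem_erase ht),
      ?_, ?_, fun v => ?_, ?_⟩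
    · rw [disjoint_insert_right]
      refine ⟨?_, disjoint_of_subset_left (erase_subset _ _) hdisj⟩
      rcases hxs with rfl | ⟨hs, -⟩
      · simp
      · exact fun h => hs (mem_of_mem_erase h)
    · rw [card_insert_of_notMem hsT]
      omega
    · rw [hAcount, filter_erase]
      have hle := card_erase_le (s := {t ∈ C' | d.right t = v}) (a := x)
      have hcv := hcount v
      split_ifs with hv
      · subst hv
        rcases hxs with rfl | ⟨hs, hxs | hxs⟩
        · have := card_erase_add_one (s := {t ∈ C' | d.right t = d.right x}) (a := x) (by simp [hx])
          omega
        · have := card_erase_add_one (s := {t ∈ C' | d.right t = d.right s}) (a := x)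
            (by simp [hx, hxs])
          omega
        · have h0 : {t ∈ C' | d.right t = d.right s} = ∅ := filter_eq_empty_iff.2 fun y hy => hxs y hy
          rw [h0] at hcv ⊢
          simp only [erase_empty, card_empty]
          omega
      · omega
    -- The minimality of `s` applies to `x` only because some unused customer could still take `x`.
    · obtain ⟨e', he'⟩ := exists_pair hsub hvalid hcount hx
      have h1 := hmin e' x he'
      rw [h.price x he'.lt_s, if_neg hxT] at h1
      have h2 := add_sum_erase C' (fun t => q - W t) hx
      omega

theorem Pending.best_of_card_eq (hpend : d.Pending u q W T A W') (hcard : d.capL u ≤ #T) :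
    d.Best u q W W' := by
  intro C hC
  obtain ⟨C', -, -, -, hc, -, hsum⟩ := hpend C hC
  have : C' = ∅ := card_eq_zero.1 (by omega)
  simpa [this] using hsum

/-- Each slot of the witness could be given to an unused customer, so by assumption it already costs
at least `q`, and the truncated difference contributes nothing. -/
theorem Pending.best_of_no_pair (hpend : d.Pending u q W T A W') (h : d.Fill u q W S T A W' S')
    (hno : ∀ e s, d.Pair u q A e s → q ≤ W' s) : d.Best u q W W' := by
  intro C hC
  obtain ⟨C', hsub, hvalid, hdisj, hc, hcount, hsum⟩ := hpend C hC
  have : ∑ s ∈ C', (q - W s) = 0 := by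
    refine sum_eq_zero fun x hx => ?_
    obtain ⟨e', he'⟩ := exists_pair hsub hvalid hcount hx
    have h1 := hno e' x he'
    rw [h.price x he'.lt_s, if_neg (disjoint_left.1 hdisj hx)] at h1
    omega
  omega

theorem Best.mono {W'' : ℕ → ℕ} (h : d.Best u q W W') (hle : d.total W' ≤ d.total W'') :
    d.Best u q W W'' :=
  fun C hC => (h C hC).trans hle

/-! ### Processing all vertices -/

variable (d) in
/-- Slot prices `W`, occupants `S` and prices `P` describe a feasible solution in which only items
`u < U` are sold. -/
structure State (U : ℕ) (W S P : ℕ → ℕ) : Prop where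
  slot : ∀ s < d.m, S s = 0 ∧ W s = 0 ∨ ∃ e < d.m, S s = e + 1 ∧ d.Valid s ∧
    d.right e = d.right s ∧ d.left e < U ∧ W s = P (d.left e) ∧ P (d.left e) ≤ d.budget e
  inj : ∀ s < d.m, ∀ s' < d.m, S s ≠ 0 → S s = S s' → s = s'
  card : ∀ u, #{s ∈ range d.m | S s ≠ 0 ∧ d.left (S s - 1) = u} ≤ d.capL u

theorem State.zero (hW : ∀ s < d.m, W s = 0) (hS : ∀ s < d.m, S s = 0) (P : ℕ → ℕ) :
    d.State 0 W S P := by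
  refine ⟨fun s hs => Or.inl ⟨hS s hs, hW s hs⟩, fun s hs s' hs' h => (h (hS s hs)).elim,
    fun u => ?_⟩
  have : {s ∈ range d.m | S s ≠ 0 ∧ d.left (S s - 1) = u} = ∅ := by
    refine filter_eq_empty_iff.2 fun s hs => ?_
    simp [hS s (mem_range.1 hs)]
  simp [this]

/-- New occupants are customers of `U` and retained ones belong to earlier items. Hence no customer
occupies two slots, the update of the price of `U` affects no retained customer, and evictions only
relax the capacities of earlier items. -/
theorem State.step {U : ℕ} {P : ℕ → ℕ} (h : d.State U W S P) (hf : d.Fill U q W S T A W' S') :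
    d.State (U + 1) W' S' (Function.update P U q) := by
  have hnew : ∀ s ∈ T, ∃ e < d.m, S' s = e + 1 ∧ d.right e = d.right s ∧ d.left e = U ∧
      q ≤ d.budget e := by
    intro s hs
    obtain ⟨e, he, h1, h2⟩ := hf.new s hs
    obtain ⟨h3, h4, h5⟩ := hf.customer e he
    exact ⟨e, h3, h1, h2, h4, h5⟩
  have hold : ∀ s < d.m, s ∉ T → S' s ≠ 0 → ∃ e, S' s = e + 1 ∧ d.left e < U := by
    intro s hs hsT h0
    rw [hf.old s hs hsT] at h0 ⊢
    rcases h.slot s hs with ⟨h1, -⟩ | ⟨e, -, h1, -, -, h2, -⟩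
    · exact (h0 h1).elim
    · exact ⟨e, h1, h2⟩
  refine ⟨fun s hs => ?_, fun s hs s' hs' h0 hss => ?_, fun u => ?_⟩
  · by_cases hsT : s ∈ T
    · obtain ⟨e, he, h1, h2, h3, h4⟩ := hnew s hsT
      refine Or.inr ⟨e, he, h1, hf.valid s hsT, h2, by omega, ?_, ?_⟩
      · rw [hf.price s hs, if_pos hsT, h3, Function.update_self]
      · rwa [h3, Function.update_self]
    · rw [hf.price s hs, hf.old s hs hsT, if_neg hsT]
      refine (h.slot s hs).imp id ?_
      rintro ⟨e, he, h1, h2, h3, h4, h5, h6⟩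
      refine ⟨e, he, h1, h2, h3, by omega, ?_, ?_⟩ <;>
        rwa [Function.update_of_ne (by omega)]
  · by_cases hsT : s ∈ T <;> by_cases hsT' : s' ∈ T
    · exact hf.inj hsT hsT' hss
    · obtain ⟨e, -, h1, -, h2, -⟩ := hnew s hsT
      obtain ⟨e', h1', h2'⟩ := hold s' hs' hsT' (by omega)
      have : e = e' := by omega
      subst this
      omega
    · obtain ⟨e, -, h1, -, h2, -⟩ := hnew s' hsT'
      obtain ⟨e', h1', h2'⟩ := hold s hs hsT h0
      have : e = e' := by omega
      subst this
      omega
    · rw [hf.old s hs hsT, hf.old s' hs' hsT'] at hss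
      rw [hf.old s hs hsT] at h0
      exact h.inj s hs s' hs' h0 hss
  · by_cases hu : u = U
    · subst hu
      refine (card_le_card fun s hs => ?_).trans hf.card
      rw [mem_filter, mem_range] at hs
      obtain ⟨hs, h1, h2⟩ := hs
      by_contra hsT
      obtain ⟨e', h1', h2'⟩ := hold s hs hsT h1
      rw [h1', Nat.add_sub_cancel] at h2
      omega
    · refine (card_le_card fun s hs => ?_).trans (h.card u)
      rw [mem_filter, mem_range] at hs ⊢
      obtain ⟨hs, h1, h2⟩ := hs
      by_cases hsT : s ∈ T
      · obtain ⟨e', -, h1', -, h2', -⟩ := hnew s hsT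
        rw [h1', Nat.add_sub_cancel] at h2
        omega
      · rw [hf.old s hs hsT] at h1 h2
        exact ⟨hs, h1, h2⟩

variable (d) in
/-- The solution with slot prices `W` competes with all solutions that sell only items `u < U`. -/
def Competitive (U : ℕ) (W : ℕ → ℕ) : Prop :=
  ∀ (q : ℕ → ℕ) (C : ℕ → Finset ℕ),
    (∀ u < U, C u = ∅ ∨ (∃ e < d.m, d.left e = u ∧ d.budget e = q u) ∧ d.Admissible u (q u) (C u)) →
    ∑ u ∈ range U, #(C u) * q u ≤ d.total W + ∑ u ∈ range U, ∑ s ∈ C u, W s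

theorem Competitive.zero (W : ℕ → ℕ) : d.Competitive 0 W := fun q C _ => by simp

/-- For earlier items the bound survives because slot prices never decrease. For `U`, split its
revenue into the gains over the old prices, which the increase of the total covers, and the old
prices themselves. The sets `C u` need not be disjoint here; disjointness enters only in
`Competitive.sum_le`. -/
theorem Competitive.step {U : ℕ} (h : d.Competitive U W) (hle : ∀ s < d.m, W s ≤ W' s)
    (hbest : ∀ e < d.m, d.left e = U → d.Best U (d.budget e) W W') : d.Competitive (U + 1) W' := by
  intro q C hC
  have h1 := h q C fun u hu => hC u (by omega)
  have htot : d.total W ≤ d.total W' := sum_le_sum fun s hs => hle s (mem_range.1 hs)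
  have hsub : ∀ u < U + 1, C u ⊆ range d.m := by
    intro u hu
    rcases hC u hu with h0 | ⟨-, h0⟩
    · simp [h0]
    · exact h0.sub
  have hmono : ∀ u < U + 1, ∑ s ∈ C u, W s ≤ ∑ s ∈ C u, W' s := fun u hu =>
    sum_le_sum fun s hs => hle s (mem_range.1 (hsub u hu hs))
  have h2 : ∑ u ∈ range U, ∑ s ∈ C u, W s ≤ ∑ u ∈ range U, ∑ s ∈ C u, W' s :=
    sum_le_sum fun u hu => hmono u (by have := mem_range.1 hu; omega)
  rw [sum_range_succ, sum_range_succ]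
  rcases hC U (by omega) with h0 | ⟨⟨e, he, heU, heq⟩, hadm⟩
  · simp only [h0, card_empty, zero_mul, sum_empty]
    omega
  · have h3 := hbest e he heU (C U) (heq ▸ hadm)
    rw [heq] at h3
    -- An inequality, since truncated subtraction counts slots dearer than `q U` with gain zero.
    have h4 : #(C U) * q U ≤ ∑ s ∈ C U, (q U - W s) + ∑ s ∈ C U, W s := by
      rw [← sum_add_distrib, ← smul_eq_mul, ← sum_const]
      exact sum_le_sum fun s _ => by omega
    have h5 := hmono U (by omega)
    omega

/-! ### Comparing slot prices with sets of customers -/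

variable (d) in
open Classical in
/-- Each vertex `v` has `capR v` valid slots unless all its slots are valid. -/
theorem card_valid (v n : ℕ) : #{s ∈ range n | d.right s = v ∧ d.Valid s} =
    min #{s ∈ range n | d.right s = v} (d.capR v) := by
  induction n with
  | zero => simp
  | succ n ih =>
    rw [range_add_one, filter_insert, filter_insert]
    by_cases hv : d.right n = v
    · have hval : d.Valid n ↔ #{s ∈ range n | d.right s = v} < d.capR v := by
        rw [Valid, hv]
      rw [if_pos hv, card_insert_of_notMem (by simp)]
      by_cases hn : d.Valid n
      · rw [if_pos ⟨hv, hn⟩, card_insert_of_notMem (by simp), ih]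
        have := hval.1 hn
        omega
      · rw [if_neg (fun h => hn h.2), ih]
        have := mt hval.2 hn
        omega
    · rw [if_neg hv, if_neg (fun h => hv h.1), ih]

variable (d) in
-- At `v` the customers of `F` number at most `capR v` and at most the degree of `v`; by
-- `card_valid` the valid slots number exactly the smaller of the two.
theorem exists_valid_slots {F : Finset ℕ} (hF : F ⊆ range d.m)
    (hcap : ∀ v, #{e ∈ F | d.right e = v} ≤ d.capR v) :
    ∃ σ : ℕ → ℕ, Set.InjOn σ F ∧
      ∀ e ∈ F, σ e < d.m ∧ d.Valid (σ e) ∧ d.right (σ e) = d.right e := by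
  classical
  have key : ∀ v, ∃ σ : ℕ → ℕ, (∀ e ∈ F, d.right e = v →
      σ e < d.m ∧ d.right (σ e) = v ∧ d.Valid (σ e)) ∧
      ∀ e ∈ F, ∀ e' ∈ F, d.right e = v → d.right e' = v → σ e = σ e' → e = e' := by
    intro v
    have hle : #{e ∈ F | d.right e = v} ≤ #{s ∈ range d.m | d.right s = v ∧ d.Valid s} := by
      rw [card_valid]
      exact le_min (card_le_card (filter_subset_filter _ hF)) (hcap v)
    set X : Finset ℕ := {e ∈ F | d.right e = v} with hX
    set Y : Finset ℕ := {s ∈ range d.m | d.right s = v ∧ d.Valid s} with hY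
    obtain ⟨σ, h1, h2⟩ := Set.Finite.exists_injOn_of_encard_le (s := (X : Set ℕ)) (t := (Y : Set ℕ)) X.finite_toSet (by
      rw [Set.encard_coe_eq_coe_finsetCard, Set.encard_coe_eq_coe_finsetCard]
      exact_mod_cast hle)
    have hmem : ∀ e ∈ F, d.right e = v → e ∈ X := fun e he hv => by simp [hX, he, hv]
    refine ⟨σ, fun e he hv => ?_, fun e he e' he' hv hv' hee => ?_⟩
    · have := h1 (mem_coe.2 (hmem e he hv))
      simpa [hY] using this
    · exact h2 (hmem e he hv) (hmem e' he' hv') hee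
  choose σ hmaps hinj using key
  refine ⟨fun e => σ (d.right e) e, fun e he e' he' hee => ?_, fun e he => ?_⟩
  · obtain ⟨-, h1, -⟩ := hmaps _ e he rfl
    obtain ⟨-, h2, -⟩ := hmaps _ e' he' rfl
    simp only at hee
    have hr : d.right e = d.right e' := by rw [← h1, ← h2, hee]
    exact hinj _ e he e' he' rfl hr.symm (by rw [hee, hr])
  · obtain ⟨h1, h2, h3⟩ := hmaps _ e he rfl
    exact ⟨h1, h3, h2⟩

/-- A competitive solution has at least half of the value of each solution. -/
theorem Competitive.sum_le {U : ℕ} (h : d.Competitive U W) {F : Finset ℕ} (hF : F ⊆ range d.m)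
    (hL : ∀ u, #{e ∈ F | d.left e = u} ≤ d.capL u) (hR : ∀ v, #{e ∈ F | d.right e = v} ≤ d.capR v)
    {p : ℕ → ℕ} (hU : ∀ e ∈ F, d.left e < U) (hp : ∀ e ∈ F, p (d.left e) ≤ d.budget e)
    (hp' : ∀ e ∈ F, ∃ e' < d.m, d.left e' = d.left e ∧ d.budget e' = p (d.left e)) :
    ∑ e ∈ F, p (d.left e) ≤ 2 * d.total W := by
  classical
  obtain ⟨σ, hinj, hσ⟩ := d.exists_valid_slots hF hR
  set C : ℕ → Finset ℕ := fun u => {e ∈ F | d.left e = u}.image σ with hC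
  have hcard : ∀ u, #(C u) = #{e ∈ F | d.left e = u} := fun u =>
    card_image_of_injOn (hinj.mono (coe_subset.2 (filter_subset _ _)))
  have hmem : ∀ u, ∀ s ∈ C u, ∃ e ∈ F, d.left e = u ∧ σ e = s := by
    intro u s hs
    simpa [hC, and_assoc] using hs
  have h1 := h p C fun u hu => by
    rcases (C u).eq_empty_or_nonempty with h0 | ⟨s, hs⟩
    · exact Or.inl h0
    · right
      obtain ⟨e, he, rfl, rfl⟩ := hmem u s hs
      refine ⟨hp' e he, ?_, ?_, (hcard _).trans_le (hL _), fun v => ?_⟩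
      · intro s hs
        obtain ⟨e', he', -, rfl⟩ := hmem _ s hs
        exact mem_range.2 (hσ e' he').1
      · intro s hs
        obtain ⟨e', he', -, rfl⟩ := hmem _ s hs
        exact (hσ e' he').2.1
      · have hsub : {s ∈ C (d.left e) | d.right s = v} ⊆
            (d.eligible (d.left e) (p (d.left e)) v).image σ := by
          intro s hs
          rw [mem_filter] at hs
          obtain ⟨e', he', hl, rfl⟩ := hmem _ s hs.1
          refine mem_image_of_mem σ ?_
          rw [eligible, mem_filter]
          refine ⟨hF he', hl, ?_, by rw [← hs.2, (hσ e' he').2.2]⟩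
          rw [← hl]
          exact hp e' he'
        exact (card_le_card hsub).trans card_image_le
  have hlhs : ∑ u ∈ range U, #(C u) * p u = ∑ e ∈ F, p (d.left e) := by
    rw [← sum_fiberwise_of_maps_to (t := range U) (g := d.left) fun e he => mem_range.2 (hU e he)]
    refine sum_congr rfl fun u _ => ?_
    rw [hcard, ← smul_eq_mul, ← sum_const]
    exact sum_congr rfl fun e he => by rw [(mem_filter.1 he).2]
  -- Injectivity of `σ` makes the slot sets of different items disjoint, so every slot price is
  -- counted at most once.
  have hrhs : ∑ u ∈ range U, ∑ s ∈ C u, W s ≤ d.total W := by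
    rw [← sum_biUnion]
    · refine sum_le_sum_of_subset fun s hs => ?_
      obtain ⟨u, -, hs⟩ := mem_biUnion.1 hs
      obtain ⟨e, he, -, rfl⟩ := hmem u s hs
      exact mem_range.2 (hσ e he).1
    · intro u _ w _ huw
      rw [Function.onFun, disjoint_left]
      intro s hs hs'
      obtain ⟨e, he, rfl, rfl⟩ := hmem u s hs
      obtain ⟨e', he', rfl, hee⟩ := hmem w _ hs'
      exact huw (by rw [hinj he' he hee])
  omega

/-- The set of customers served. -/
def served (d : SlotData) (S : ℕ → ℕ) : Finset ℕ := {e ∈ range d.m | ∃ s < d.m, S s = e + 1}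

theorem State.exists_slot {U : ℕ} {P : ℕ → ℕ} (h : d.State U W S P) {e : ℕ}
    (he : e ∈ d.served S) : ∃ s < d.m, S s = e + 1 ∧ d.Valid s ∧ d.right e = d.right s ∧
      W s = P (d.left e) ∧ P (d.left e) ≤ d.budget e := by
  rw [served, mem_filter] at he
  obtain ⟨-, s, hs, hse⟩ := he
  rcases h.slot s hs with ⟨h0, -⟩ | ⟨e', he', h1, h2, h3, -, h4, h5⟩
  · omega
  · have : e' = e := by omega
    subst this
    exact ⟨s, hs, h1, h2, h3, h4, h5⟩

/-- Occupied slots and served customers correspond bijectively, and an empty slot has price zero. -/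
theorem State.sum_served {U : ℕ} {P : ℕ → ℕ} (h : d.State U W S P) :
    ∑ e ∈ d.served S, P (d.left e) = d.total W := by
  have h1 : d.total W = ∑ s ∈ range d.m with S s ≠ 0, W s := by
    rw [total, sum_filter]
    refine sum_congr rfl fun s hs => ?_
    split_ifs with h0
    · rfl
    · push Not at h0
      rcases h.slot s (mem_range.1 hs) with ⟨-, h1⟩ | ⟨e, -, h1, -⟩
      · exact h1
      · omega
  rw [h1]
  symm
  refine sum_nbij (fun s => S s - 1) ?_ ?_ ?_ ?_
  · intro s hs
    rw [mem_filter, mem_range] at hs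
    rcases h.slot s hs.1 with ⟨h1, -⟩ | ⟨e, he, h1, -⟩
    · exact (hs.2 h1).elim
    · rw [served, mem_filter, mem_range, h1]
      exact ⟨by omega, s, hs.1, by omega⟩
  · intro s hs s' hs' hss
    rw [mem_coe, mem_filter, mem_range] at hs hs'
    simp only at hss
    exact h.inj s hs.1 s' hs'.1 hs.2 (by omega)
  · intro e he
    obtain ⟨s, hs, h1, -⟩ := h.exists_slot he
    refine ⟨s, ?_, by simp [h1]⟩
    rw [mem_coe, mem_filter, mem_range]
    exact ⟨hs, by omega⟩
  · intro s hs
    rw [mem_filter, mem_range] at hs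
    rcases h.slot s hs.1 with ⟨h1, -⟩ | ⟨e, he, h1, -, -, -, h2, -⟩
    · exact (hs.2 h1).elim
    · rw [h1, Nat.add_sub_cancel, h2]

theorem State.le_budget {U : ℕ} {P : ℕ → ℕ} (h : d.State U W S P) {e : ℕ} (he : e ∈ d.served S) :
    P (d.left e) ≤ d.budget e := by
  obtain ⟨-, -, -, -, -, -, h1⟩ := h.exists_slot he
  exact h1

theorem State.card_left {U : ℕ} {P : ℕ → ℕ} (h : d.State U W S P) (u : ℕ) :
    #{e ∈ d.served S | d.left e = u} ≤ d.capL u := by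
  refine (card_le_card fun e he => ?_).trans ((card_image_le (f := fun s => S s - 1)).trans (h.card u))
  rw [mem_filter] at he
  obtain ⟨s, hs, h1, -⟩ := h.exists_slot he.1
  refine mem_image.2 ⟨s, ?_, by omega⟩
  rw [mem_filter, mem_range, h1, Nat.add_sub_cancel]
  exact ⟨hs, by omega, he.2⟩

theorem State.card_right {U : ℕ} {P : ℕ → ℕ} (h : d.State U W S P) (v : ℕ) :
    #{e ∈ d.served S | d.right e = v} ≤ d.capR v := by
  classical
  have hle := (d.card_valid v d.m).trans_le (min_le_right _ _)
  refine (card_le_card fun e he => ?_).trans ((card_image_le (f := fun s => S s - 1)).trans hle)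
  rw [mem_filter] at he
  obtain ⟨s, hs, h1, h2, h3, -⟩ := h.exists_slot he.1
  refine mem_image.2 ⟨s, ?_, by omega⟩
  rw [mem_filter, mem_range, ← h3]
  exact ⟨hs, he.2, h2⟩

end SlotData

/-! ### The program -/

namespace RAM

namespace Expr

/-- The first cell of a bank, used as a variable. -/
abbrev var (b : ℕ) : Expr := .read b (.const 0)

abbrev add (a b : Expr) : Expr := .op .add a b
abbrev sub (a b : Expr) : Expr := .op .sub a b
abbrev mul (a b : Expr) : Expr := .op .mul a b
abbrev div (a b : Expr) : Expr := .op .div a b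
abbrev eq (a b : Expr) : Expr := .op .eq a b
abbrev lt (a b : Expr) : Expr := .op .lt a b

/-- Nonzero if the capacity with code `c` exceeds `n`. -/
abbrev fits (c n : Expr) : Expr := add (eq c (.const 0)) (lt (add n (.const 1)) c)

end Expr

namespace LoopProg

/-- Copy the arrays in banks `a'` and `b'` to banks `a` and `b`. -/
def copy (a b a' b' : ℕ) : LoopProg :=
  loop 27 2 (seq (assign a (.var 27) (.read a' (.var 27))) (assign b (.var 27) (.read b' (.var 27))))

theorem copy_spec {a b a' b' : ℕ} (hab : a ≠ b) (ha : a ≠ 27) (hb : b ≠ 27) (ha' : a' ≠ a)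
    (ha'b : a' ≠ b) (hb'a : b' ≠ a) (hb' : b' ≠ b) (ha'27 : a' ≠ 27) (hb'27 : b' ≠ 27)
    (s : Store) :
    ∀ i < s 0 2, (copy a b a' b').run s a i = s a' i ∧ (copy a b a' b').run s b i = s b' i := by
  refine run_loop_induction (fun k s' => ∀ i < k, s' a i = s a' i ∧ s' b i = s b' i) ?_ ?_
  · simp
  · intro k hk s' hs' hfr ih i hi
    have h1 := hfr a' (by simp [*]) (by simp [writes, *])
    have h2 := hfr b' (by simp [*]) (by simp [writes, *])
    by_cases hik : i = k
    · subst hik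
      simp [run, Expr.eval, Store.write_apply, hs', h1, h2, hab, ha.symm, hb'a, ha, hb]
    · have := ih i (by omega)
      simp [run, Expr.eval, Store.write_apply, hs', hik, ha.symm, ha, hb, this]

end LoopProg

end RAM

namespace Pricing

open RAM RAM.LoopProg RAM.Expr Finset

/-! Memory banks: `0` input, `1` output, `2` common denominator, `3` scaled budgets, `4` valid slots,
`5` counters of the vertices of `R`; `6`, `7` slot prices and occupants, `8` item prices; `9`, `10`
slot prices and occupants of a trial, `11` used customers, `12` number of sales, `13` total of the
trial; `14`, `15`, `16`, `17` slot prices, occupants, total, and item price of the best trial; `18`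
price of the trial, `19`, `20`, `21` price, customer and slot of the best pair, `22`–`27` loop counters,
`28` total before the trials. -/

/-- The position in the input of the block that follows the capacities and `k` blocks of length
`numE`. -/
def blockE : ℕ → Expr
  | 0 => add (add (.const 3) (.read 0 (.const 0))) (.read 0 (.const 1))
  | k + 1 => add (blockE k) (.read 0 (.const 2))

def leftE (e : Expr) : Expr := .read 0 (add (blockE 0) e)
def rightE (e : Expr) : Expr := .read 0 (add (blockE 1) e)
def numE (e : Expr) : Expr := .read 0 (add (blockE 2) e)
def denE (e : Expr) : Expr := .read 0 (add (blockE 3) e)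
def capLE (u : Expr) : Expr := .read 0 (add (.const 3) u)
def capRE (v : Expr) : Expr := .read 0 (add (add (.const 3) (.read 0 (.const 0))) v)

/-- The value of `blockE`. -/
def block (inp : ℕ → ℕ) : ℕ → ℕ
  | 0 => 3 + inp 0 + inp 1
  | k + 1 => block inp k + inp 2

/-- A capacity, given by its code, as a number that is at most the number `m` of edges. -/
def effCap (m c : ℕ) : ℕ := if c = 0 then m else min m (c - 1)

/-- The product of the denominators of the budgets. -/
def inputDen (inp : ℕ → ℕ) : ℕ := ∏ e ∈ range (inp 2), inp (block inp 3 + e)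

/-- The integral instance described by an input. -/
def data (inp : ℕ → ℕ) : SlotData where
  m := inp 2
  left e := inp (block inp 0 + e)
  right e := inp (block inp 1 + e)
  budget e := inputDen inp / inp (block inp 3 + e) * inp (block inp 2 + e)
  capL u := effCap (inp 2) (inp (3 + u))
  capR v := effCap (inp 2) (inp (3 + inp 0 + v))

theorem effCap_le (m c : ℕ) : effCap m c ≤ m := by
  unfold effCap
  split_ifs <;> omega

/-- Below `m` the truncation at `m` is invisible, so the program can test the raw code of a
capacity. -/
theorem lt_effCap {m c n : ℕ} (hn : n < m) : n < effCap m c ↔ c = 0 ∨ n + 1 < c := by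
  unfold effCap
  split_ifs <;> omega

theorem fits_ne_zero (s : Store) (c n : Expr) :
    (fits c n).eval s ≠ 0 ↔ c.eval s = 0 ∨ n.eval s + 1 < c.eval s := by
  by_cases h1 : c.eval s = 0 <;> by_cases h2 : n.eval s + 1 < c.eval s <;>
    simp [Expr.eval, Op.eval, h1, h2]

theorem blockE_eval (s : Store) (k : ℕ) : (blockE k).eval s = block (s 0) k := by
  induction k with
  | zero => rfl
  | succ k ih => simp [blockE, block, Expr.eval, Op.eval, ih]

theorem leftE_eval (s : Store) (e : Expr) : (leftE e).eval s = (data (s 0)).left (e.eval s) := by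
  simp [leftE, Expr.eval, Op.eval, blockE_eval, data]

theorem rightE_eval (s : Store) (e : Expr) : (rightE e).eval s = (data (s 0)).right (e.eval s) := by
  simp [rightE, Expr.eval, Op.eval, blockE_eval, data]

theorem numE_eval (s : Store) (e : Expr) : (numE e).eval s = s 0 (block (s 0) 2 + e.eval s) := by
  simp [numE, Expr.eval, Op.eval, blockE_eval]

theorem denE_eval (s : Store) (e : Expr) : (denE e).eval s = s 0 (block (s 0) 3 + e.eval s) := by
  simp [denE, Expr.eval, Op.eval, blockE_eval]

def denominators : LoopProg :=
  seq (assign 2 (.const 0) (.const 1)) (loop 25 2 (assign 2 (.const 0) (mul (var 2) (denE (var 25)))))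

/-- Division comes first: it is exact, and the product keeps an input cell as its second factor. -/
def budgets : LoopProg :=
  loop 25 2 (assign 3 (var 25) (mul (div (var 2) (denE (var 25))) (numE (var 25))))

/-- The counter of a vertex is read before it is increased, so it holds the number of earlier edges
there. -/
def validSlots : LoopProg :=
  loop 25 2 (seq
    (assign 4 (var 25) (fits (capRE (rightE (var 25))) (.read 5 (rightE (var 25)))))
    (assign 5 (rightE (var 25)) (add (.read 5 (rightE (var 25))) (.const 1))))

/-- The customer in variable `25` can be assigned to the slot in variable `26` at a lower price than
those seen before. -/
def pairTest : Expr :=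
  -- A conjunction as a product of truth values, each of which is small in the sense of
  -- `Expr.small`. Adding one to the budget turns the strict comparison into a weak one.
  mul (mul (mul (mul (mul (lt (.read 9 (var 26)) (var 19)) (eq (leftE (var 25)) (var 22)))
    (lt (var 18) (add (.read 3 (var 25)) (.const 1)))) (eq (.read 11 (var 25)) (.const 0)))
    (lt (.const 0) (.read 4 (var 26)))) (eq (rightE (var 25)) (rightE (var 26)))

/-- Inspect the pair in variables `25` and `26`. -/
def inspect : LoopProg :=
  ite pairTest (seq (assign 19 (.const 0) (.read 9 (var 26)))
    (seq (assign 20 (.const 0) (add (var 25) (.const 1))) (assign 21 (.const 0) (var 26)))) skip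

/-- Find a pair of a customer and a slot of minimum price. -/
def scan : LoopProg :=
  seq (assign 19 (.const 0) (var 18)) (seq (assign 20 (.const 0) (.const 0))
    (loop 25 2 (loop 26 2 inspect)))

/-- Assign the customer found to the slot found. -/
def commit : LoopProg :=
  ite (mul (fits (capLE (var 22)) (var 12)) (lt (.const 0) (var 20)))
    (seq (assign 10 (var 21) (var 20)) (seq (assign 9 (var 21) (var 18))
      (seq (assign 11 (sub (var 20) (.const 1)) (.const 1))
        (seq (assign 12 (.const 0) (add (var 12) (.const 1)))
          (assign 13 (.const 0) (add (var 13) (sub (var 18) (var 19)))))))) skip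

/-- Assign customers for the item in variable `22` at the price in variable `18` greedily. -/
def trial : LoopProg :=
  seq (copy 9 10 6 7) (seq (loop 27 2 (assign 11 (var 27) (.const 0)))
    (seq (assign 12 (.const 0) (.const 0)) (seq (assign 13 (.const 0) (var 28))
      (loop 24 2 (seq scan commit)))))

/-- Keep the trial if it is the best one so far. -/
def keep : LoopProg :=
  ite (lt (var 16) (var 13)) (seq (assign 16 (.const 0) (var 13)) (seq (assign 17 (.const 0) (var 18))
    (copy 14 15 9 10))) skip

/-- Try the budget of the customer in variable `23` as the price of the item in variable `22`. -/
def candidate : LoopProg :=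
  ite (eq (leftE (var 23)) (var 22)) (seq (assign 18 (.const 0) (.read 3 (var 23))) (seq trial keep))
    skip

/-- Fix the price of the item in variable `22`. -/
def vertex : LoopProg :=
  seq (assign 28 (.const 0) (var 16)) (seq (copy 14 15 6 7) (seq (loop 23 2 candidate)
    (seq (copy 6 7 14 15) (assign 8 (var 22) (var 17)))))

def writePrices : LoopProg :=
  loop 22 0 (seq (assign 1 (add (var 22) (var 22)) (.read 8 (var 22)))
    (assign 1 (add (add (var 22) (var 22)) (.const 1)) (var 2)))

def writeServed : LoopProg :=
  loop 26 2 (ite (lt (.const 0) (.read 7 (var 26)))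
    (assign 1 (add (add (.read 0 (.const 0)) (.read 0 (.const 0)))
      (sub (.read 7 (var 26)) (.const 1))) (.const 1)) skip)

def program : LoopProg :=
  seq denominators (seq budgets (seq validSlots (seq (loop 22 0 vertex)
    (seq writePrices writeServed))))

theorem program_tame : program.tame = true := by decide

end Pricing

namespace SlotData

open Finset

variable {d : SlotData} {u q : ℕ} {W S W' S' W'' S'' : ℕ → ℕ} {T A : Finset ℕ}

theorem Fill.congr (h : d.Fill u q W S T A W' S') (hW : ∀ s < d.m, W'' s = W' s)
    (hS : ∀ s < d.m, S'' s = S' s) : d.Fill u q W S T A W'' S'' where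
  sub := h.sub
  valid := h.valid
  le := h.le
  price s hs := by rw [hW s hs, h.price s hs]
  old s hs hsT := by rw [hS s hs, h.old s hs hsT]
  new s hs := by
    rw [hS s (mem_range.1 (h.sub hs))]
    exact h.new s hs
  inj s hs s' hs' hss := by
    rw [hS s (mem_range.1 (h.sub hs)), hS s' (mem_range.1 (h.sub hs'))] at hss
    exact h.inj hs hs' hss
  customer := h.customer
  count := h.count
  card := h.card

theorem Best.congr (h : d.Best u q W W') (hW : ∀ s < d.m, W'' s = W' s) : d.Best u q W W'' :=
  h.mono (total_congr hW).ge

end SlotData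

namespace Pricing

open RAM RAM.LoopProg Finset SlotData

variable {inp : ℕ → ℕ} {s : Store}

/-- The quantities computed from the input are in place. -/
structure Ready (inp : ℕ → ℕ) (s : Store) : Prop where
  input : s 0 = inp
  den : s 2 0 = inputDen inp
  budget : ∀ e < inp 2, s 3 e = (data inp).budget e
  valid : ∀ i < inp 2, s 4 i ≠ 0 ↔ (data inp).Valid i

theorem Ready.congr (h : Ready inp s) {s' : Store} (hs : ∀ b ∈ [0, 2, 3, 4], s' b = s b) :
    Ready inp s' := by
  have h0 := hs 0 (by decide)
  have h2 := hs 2 (by decide)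
  have h3 := hs 3 (by decide)
  have h4 := hs 4 (by decide)
  exact ⟨h0 ▸ h.input, h2 ▸ h.den, h3 ▸ h.budget, h4 ▸ h.valid⟩

theorem Ready.run (h : Ready inp s) (c : LoopProg) (hc : ∀ b ∈ [0, 2, 3, 4], b ∉ c.writes) :
    Ready inp (c.run s) :=
  h.congr fun b hb => run_frame _ _ _ (hc b hb)

/-! #### Preprocessing -/

/-- The counters of bank 5 must start at zero. Fewer than `m` edges precede any edge, so `lt_effCap`
applies to the capacity test. -/
theorem ready_preprocessing (s : Store) (h5 : ∀ v, s 5 v = 0) :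
    Ready (s 0) (validSlots.run (budgets.run (denominators.run s))) := by
  set s₁ := denominators.run s with hs₁
  have h10 : s₁ 0 = s 0 := run_frame _ _ _ (by decide)
  have h12 : s₁ 2 0 = inputDen (s 0) := by
    have := run_loop_induction (x := 25) (j := 2)
      (c := .assign 2 (.const 0) (.mul (.var 2) (denE (.var 25))))
      (s := s.write 2 0 1)
      (fun k s' => s' 2 0 = ∏ e ∈ range k, s 0 (block (s 0) 3 + e)) ?_ ?_
    · simpa [hs₁, denominators, run, Expr.eval, inputDen, Store.write_bank_ne] using this
    · simp [Store.write_apply]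
    · intro k hk s' hs' hfr ih
      have h0 : s' 0 = s 0 := by
        rw [hfr 0 (by decide) (by decide), Store.write_bank_ne _ _ _ (by decide)]
      simp [run, Expr.eval, Op.eval, Store.write_apply, denE_eval, h0, ih, hs', prod_range_succ]
  set s₂ := budgets.run s₁ with hs₂
  have h20 : s₂ 0 = s 0 := (run_frame _ _ _ (by decide)).trans h10
  have h23 : ∀ e < s 0 2, s₂ 3 e = (data (s 0)).budget e := by
    rw [← h10]
    refine run_loop_induction (fun k s' => ∀ e < k, s' 3 e = (data (s₁ 0)).budget e) ?_ ?_
    · simp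
    · intro k hk s' hs' hfr ih e he
      have h0 : s' 0 = s₁ 0 := hfr 0 (by decide) (by decide)
      have h2 : s' 2 = s₁ 2 := hfr 2 (by decide) (by decide)
      by_cases hek : e = k
      · simp [run, Expr.eval, Op.eval, Store.write_apply, denE_eval, numE_eval, h0, h2, h12, hs', hek,
          data, h10]
      · simp [run, Expr.eval, Store.write_apply, hs', hek, ih e (by omega)]
  have h25 : s₂ 5 = s 5 := by
    rw [hs₂, run_frame _ _ _ (by decide), hs₁, run_frame _ _ _ (by decide)]
  set s₃ := validSlots.run s₂ with hs₃
  have h3 : (∀ i < s₂ 0 2, s₃ 4 i ≠ 0 ↔ (data (s₂ 0)).Valid i) ∧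
      ∀ v, s₃ 5 v = #{i ∈ range (s₂ 0 2) | (data (s₂ 0)).right i = v} := by
    refine run_loop_induction (fun k s' => (∀ i < k, s' 4 i ≠ 0 ↔ (data (s₂ 0)).Valid i) ∧
      ∀ v, s' 5 v = #{i ∈ range k | (data (s₂ 0)).right i = v}) ?_ ?_
    · simp [Store.write_apply, h25, h5]
    · rintro k hk s' hs' hfr ⟨ih1, ih2⟩
      have h0 : s' 0 = s₂ 0 := hfr 0 (by decide) (by decide)
      refine ⟨fun i hi => ?_, fun v => ?_⟩
      · by_cases hik : i = k
        · subst hik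
          have hlt : #{t ∈ range i | (data (s₂ 0)).right t = (data (s₂ 0)).right i} < s₂ 0 2 :=
            ((card_filter_le _ _).trans_eq (card_range i)).trans_lt hk
          have h1 := fits_ne_zero s' (capRE (rightE (.var 25))) (.read 5 (rightE (.var 25)))
          have h2 : (capRE (rightE (.var 25))).eval s' =
              s₂ 0 (3 + s₂ 0 0 + (data (s₂ 0)).right i) := by
            simp [capRE, Expr.eval, Op.eval, rightE_eval, h0, hs']
          have h3 : (Expr.read 5 (rightE (.var 25))).eval s' =
              #{t ∈ range i | (data (s₂ 0)).right t = (data (s₂ 0)).right i} := by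
            simp [Expr.eval, rightE_eval, h0, hs', ih2]
          rw [h2, h3, ← lt_effCap hlt] at h1
          rw [Valid, show (data (s₂ 0)).capR ((data (s₂ 0)).right i) = effCap (s₂ 0 2)
            (s₂ 0 (3 + s₂ 0 0 + (data (s₂ 0)).right i)) from rfl, ← h1]
          simp only [run, Store.write_apply]
          simp [Expr.eval, hs']
        · rw [← ih1 i (by omega)]
          simp [run, Expr.eval, Store.write_apply, hs', hik]
      · rw [range_add_one, filter_insert]
        by_cases hv : (data (s₂ 0)).right k = v
        · rw [if_pos hv, card_insert_of_notMem (by simp), ← ih2]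
          simp [run, Expr.eval, Op.eval, Store.write_apply, Store.write_bank_ne, rightE_eval, h0,
            hs', hv]
        · rw [if_neg hv, ← ih2]
          simp [run, Expr.eval, Op.eval, Store.write_apply, Store.write_bank_ne, rightE_eval, h0,
            hs', Ne.symm hv]
  rw [h20] at h3
  refine ⟨(run_frame _ _ _ (by decide)).trans h20, ?_, ?_, h3.1⟩
  · rw [hs₃, run_frame _ _ _ (by decide), hs₂, run_frame _ _ _ (by decide), h12]
  · rw [hs₃, run_frame _ _ _ (by decide)]
    exact h23

/-! #### The search for a pair -/

theorem pairTest_ne_zero (s : Store) : pairTest.eval s ≠ 0 ↔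
    s 9 (s 26 0) < s 19 0 ∧ (data (s 0)).left (s 25 0) = s 22 0 ∧ s 18 0 ≤ s 3 (s 25 0) ∧
      s 11 (s 25 0) = 0 ∧ s 4 (s 26 0) ≠ 0 ∧
      (data (s 0)).right (s 25 0) = (data (s 0)).right (s 26 0) := by
  simp only [pairTest, Expr.eval, Op.eval, leftE_eval, rightE_eval, mul_ne_zero_iff, ite_ne_right_iff,
    and_assoc, Nat.lt_add_one_iff, Nat.pos_iff_ne_zero]
  by_cases h1 : s 9 (s 26 0) < s 19 0 <;> by_cases h2 : s 11 (s 25 0) = 0 <;> simp [h1, h2]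

/-- The variables `mw`, `me`, `ms` describe a cheapest pair among those with `Q`. -/
def IsCheapest (d : SlotData) (u q : ℕ) (A : Finset ℕ) (w : ℕ → ℕ) (Q : ℕ → ℕ → Prop)
    (mw me ms : ℕ) : Prop :=
  (me = 0 ∧ mw = q ∨ ∃ e i, d.Pair u q A e i ∧ me = e + 1 ∧ ms = i ∧ mw = w i ∧ w i < q) ∧
    ∀ e i, Q e i → d.Pair u q A e i → mw ≤ w i

theorem IsCheapest.le {d : SlotData} {u q : ℕ} {A : Finset ℕ} {w : ℕ → ℕ} {Q : ℕ → ℕ → Prop}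
    {mw me ms : ℕ} (h : IsCheapest d u q A w Q mw me ms) : mw ≤ q := by
  rcases h.1 with ⟨-, h⟩ | ⟨e, i, -, -, -, h1, h2⟩
  exacts [h.le, h1 ▸ h2.le]

/-- The running minimum starts at `q` and the comparison is strict. If no pair is recorded, every
assignable slot already costs at least `q`; a recorded pair has a slot strictly below `q`. -/
theorem scan_spec {u q : ℕ} {A : Finset ℕ} (hr : Ready inp s) (hu : s 22 0 = u) (hq : s 18 0 = q)
    (hA : ∀ e < inp 2, s 11 e = 0 ↔ e ∉ A) :
    (scan.run s) 20 0 = 0 ∧ (∀ e i, (data inp).Pair u q A e i → q ≤ s 9 i) ∨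
    ∃ e i, (data inp).Pair u q A e i ∧ (scan.run s) 20 0 = e + 1 ∧ (scan.run s) 21 0 = i ∧
      (scan.run s) 19 0 = s 9 i ∧ s 9 i < q ∧
      ∀ e' i', (data inp).Pair u q A e' i' → s 9 i ≤ s 9 i' := by
  set s₁ := (s.write 19 0 q).write 20 0 0 with hs₁
  have hrun : scan.run s = (LoopProg.loop 25 2 (.loop 26 2 inspect)).run s₁ := by
    simp [scan, run, Expr.eval, hs₁, hq]
  have hfr₁ : ∀ b, b ≠ 19 → b ≠ 20 → s₁ b = s b := fun b h h' => by
    rw [hs₁, Store.write_bank_ne _ _ _ h', Store.write_bank_ne _ _ _ h]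
  have h1 : IsCheapest (data inp) u q A (s 9) (fun e _ => e < s₁ 0 2) ((scan.run s) 19 0)
      ((scan.run s) 20 0) ((scan.run s) 21 0) := by
    rw [hrun]
    refine run_loop_induction (fun k s' => IsCheapest (data inp) u q A (s 9) (fun e _ => e < k)
      (s' 19 0) (s' 20 0) (s' 21 0)) ?_ ?_
    · refine ⟨Or.inl ?_, by simp⟩
      simp [hs₁, Store.write_apply]
    · intro k hk s' hs' hfr ih
      have hfr' : ∀ b, b ∉ [19, 20, 21, 25, 26] → s' b = s b := fun b hb => by
        simp only [List.mem_cons, List.not_mem_nil, or_false, not_or] at hb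
        rw [hfr b (by tauto) (by simp [writes, inspect]; tauto), hfr₁ b (by tauto) (by tauto)]
      have hm : s' 0 2 = inp 2 := by rw [hfr' 0 (by decide), hr.input]
      have hk' : k < inp 2 := by
        rw [hfr₁ 0 (by decide) (by decide), hr.input] at hk
        exact hk
      have h2 : IsCheapest (data inp) u q A (s 9) (fun e i => e < k ∨ e = k ∧ i < s' 0 2)
          (((LoopProg.loop 26 2 inspect).run s') 19 0) (((LoopProg.loop 26 2 inspect).run s') 20 0)
          (((LoopProg.loop 26 2 inspect).run s') 21 0) := by
        refine run_loop_induction (fun j s'' => IsCheapest (data inp) u q A (s 9)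
          (fun e i => e < k ∨ e = k ∧ i < j) (s'' 19 0) (s'' 20 0) (s'' 21 0)) ?_ ?_
        · simpa [Store.write_bank_ne] using ih
        · intro j hj t ht hfrt iht
          have hfrt' : ∀ b, b ∉ [19, 20, 21, 25, 26] → t b = s b := fun b hb => by
            rw [hfrt b (by rintro rfl; simp at hb) (by simp [inspect, writes]; simp at hb; tauto),
              hfr' b hb]
          have h25 : t 25 0 = k := by rw [hfrt 25 (by decide) (by decide), hs']
          rw [hm] at hj
          have htest := pairTest_ne_zero t
          rw [hfrt' 9 (by decide), hfrt' 0 (by decide), hfrt' 22 (by decide), hfrt' 18 (by decide),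
            hfrt' 3 (by decide), hfrt' 11 (by decide), hfrt' 4 (by decide), ht, h25, hu, hq, hr.input,
            hr.budget k hk', hA k hk', hr.valid j hj] at htest
          have htest' : pairTest.eval t ≠ 0 ↔ s 9 j < t 19 0 ∧ (data inp).Pair u q A k j := by
            rw [htest]
            constructor
            · rintro ⟨a1, a2, a3, a4, a5, a6⟩
              exact ⟨a1, hk', hj, a2, a3, a4, a5, a6⟩
            · rintro ⟨a1, a2⟩
              exact ⟨a1, a2.left, a2.le, a2.unused, a2.valid, a2.right⟩
          by_cases hp : pairTest.eval t = 0
          · have hnp := mt htest'.2 (not_not.2 hp)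
            have : inspect.run t = t := by simp [inspect, run, hp]
            rw [this]
            simp only [Store.write_bank_ne _ _ _ (show 19 ≠ 26 by decide),
              Store.write_bank_ne _ _ _ (show 20 ≠ 26 by decide),
              Store.write_bank_ne _ _ _ (show 21 ≠ 26 by decide)]
            refine ⟨iht.1, fun e i hei hpair => ?_⟩
            by_cases hnew : e = k ∧ i = j
            · obtain ⟨rfl, rfl⟩ := hnew
              by_contra! hlt
              exact hnp ⟨hlt, hpair⟩
            · exact iht.2 e i (by omega) hpair
          · obtain ⟨hlt, hpair⟩ := htest'.1 hp
            have h9 : t 9 = s 9 := hfrt' 9 (by decide)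
            have e19 : ((inspect.run t).write 26 0 (j + 1)) 19 0 = s 9 j := by
              simp [inspect, run, hp, Expr.eval, Store.write_apply, ht, h9]
            have e20 : ((inspect.run t).write 26 0 (j + 1)) 20 0 = k + 1 := by
              simp [inspect, run, hp, Expr.eval, Op.eval, Store.write_apply, h25]
            have e21 : ((inspect.run t).write 26 0 (j + 1)) 21 0 = j := by
              simp [inspect, run, hp, Expr.eval, Store.write_apply, ht]
            rw [e19, e20, e21]
            refine ⟨Or.inr ⟨k, j, hpair, rfl, rfl, rfl, hlt.trans_le iht.le⟩, fun e i hei hpair' => ?_⟩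
            by_cases hnew : e = k ∧ i = j
            · rw [hnew.2]
            · exact hlt.le.trans (iht.2 e i (by omega) hpair')
      simp only [run, Store.write_bank_ne _ _ _ (show 19 ≠ 25 by decide),
        Store.write_bank_ne _ _ _ (show 20 ≠ 25 by decide),
        Store.write_bank_ne _ _ _ (show 21 ≠ 25 by decide)] at h2 ⊢
      -- The inner loop has run through all slots, so the bound on `i` comes from the pair itself.
      refine ⟨h2.1, fun e i hei hpair => h2.2 e i ?_ hpair⟩
      have : i < s' 0 2 := hm ▸ hpair.lt_s
      omega
  have hm : s₁ 0 2 = inp 2 := by rw [hfr₁ 0 (by decide) (by decide), hr.input]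
  rw [hm] at h1
  rcases h1.1 with ⟨h2, h3⟩ | ⟨e, i, h2, h3, h4, h5, h6⟩
  · exact Or.inl ⟨h2, fun e i hp => h3 ▸ h1.2 e i hp.lt_e hp⟩
  · exact Or.inr ⟨e, i, h2, h3, h4, h5, h6, fun e' i' hp => h5 ▸ h1.2 e' i' hp.lt_e hp⟩

/-! #### A trial -/

/-- The invariant of the rounds of a trial. -/
def TrialInv (inp : ℕ → ℕ) (u q : ℕ) (W S : ℕ → ℕ) (r : ℕ) (s : Store) : Prop :=
  ∃ T A, (data inp).Fill u q W S T A (s 9) (s 10) ∧ (∀ e < inp 2, s 11 e = 0 ↔ e ∉ A) ∧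
    s 12 0 = #T ∧ s 13 0 = (data inp).total (s 9) ∧
    ((data inp).Pending u q W T A (s 9) ∧ #T = r ∨ (data inp).Best u q W (s 9))

/-- Either a sale is made and `Pending` is carried on, or the item is sold out or no profitable pair
exists, and then the trial is already best. Once attained, `Best` persists, because later sales only
raise the total. -/
theorem TrialInv.round {u q r : ℕ} {W S : ℕ → ℕ} (hr : Ready inp s) (hu : s 22 0 = u)
    (hq : s 18 0 = q) (h : TrialInv inp u q W S r s) :
    TrialInv inp u q W S (r + 1) (commit.run (scan.run s)) := by
  obtain ⟨T, A, hfill, hA, h12, h13, hopt⟩ := h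
  have hscan := scan_spec hr hu hq hA
  have hfr : ∀ b, b ∉ scan.writes → (scan.run s) b = s b := run_frame _ _
  set t := scan.run s with ht
  have h0 : t 0 = inp := (hfr 0 (by decide)).trans hr.input
  have t9 := hfr 9 (by decide)
  have t10 := hfr 10 (by decide)
  have t11 := hfr 11 (by decide)
  have t12 := hfr 12 (by decide)
  have t13 := hfr 13 (by decide)
  have t18 := hfr 18 (by decide)
  have t22 := hfr 22 (by decide)
  have htest : ((Expr.mul (.fits (capLE (.var 22)) (.var 12)) (.lt (.const 0) (.var 20))).eval t) ≠ 0 ↔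
      (inp (3 + u) = 0 ∨ #T + 1 < inp (3 + u)) ∧ t 20 0 ≠ 0 := by
    have h1 := fits_ne_zero t (capLE (.var 22)) (.var 12)
    have h2 : (capLE (.var 22)).eval t = inp (3 + u) := by
      simp [capLE, Expr.eval, Op.eval, h0, t22, hu]
    have h3 : (Expr.var 12).eval t = #T := by simp [Expr.eval, t12, h12]
    rw [h2, h3] at h1
    rw [← h1]
    simp only [Expr.eval, Op.eval, mul_ne_zero_iff, ite_ne_right_iff, Nat.pos_iff_ne_zero]
    simp
  rcases hscan with ⟨h20, hno⟩ | ⟨e, i, hpair, h20, h21, h19, hlt, hmin⟩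
  · have hz : (Expr.mul (.fits (capLE (.var 22)) (.var 12)) (.lt (.const 0) (.var 20))).eval t = 0 := by
      by_contra hne
      exact (htest.1 hne).2 h20
    have hrun : commit.run t = t := by
      simp only [commit, run]
      rw [if_pos hz]
    rw [hrun]
    refine ⟨T, A, by rwa [t9, t10], by rwa [t11], by rwa [t12], by rwa [t13, t9], Or.inr ?_⟩
    rw [t9]
    exact hopt.elim (fun h => h.1.best_of_no_pair hfill hno) id
  · have hiT := hfill.notMem_of_lt hpair.lt_s hlt
    have hTm : #T < inp 2 := by
      have h1 : insert i T ⊆ range (inp 2) := insert_subset (mem_range.2 hpair.lt_s) hfill.sub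
      have h2 := card_le_card h1
      rw [card_insert_of_notMem hiT, card_range] at h2
      omega
    have hcap : #T < (data inp).capL u ↔ inp (3 + u) = 0 ∨ #T + 1 < inp (3 + u) := lt_effCap hTm
    rw [← hcap] at htest
    by_cases hc : #T < (data inp).capL u
    · have hne := htest.2 ⟨hc, by omega⟩
      have hrun : commit.run t = ((((t.write 10 i (e + 1)).write 9 i q).write 11 e 1).write 12 0
          (#T + 1)).write 13 0 ((data inp).total (s 9) + (q - s 9 i)) := by
        simp only [commit, run]
        rw [if_neg hne]
        simp [Expr.eval, Op.eval, Store.write_apply, h20, h21, h19, t18, t12, t13, h12, h13, hq]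
      rw [hrun]
      have e9 : (((((t.write 10 i (e + 1)).write 9 i q).write 11 e 1).write 12 0
          (#T + 1)).write 13 0 ((data inp).total (s 9) + (q - s 9 i))) 9 =
          Function.update (s 9) i q := by
        simp [Store.write_bank, Store.write_bank_ne, t9]
      have e10 : (((((t.write 10 i (e + 1)).write 9 i q).write 11 e 1).write 12 0
          (#T + 1)).write 13 0 ((data inp).total (s 9) + (q - s 9 i))) 10 =
          Function.update (s 10) i (e + 1) := by
        simp [Store.write_bank, Store.write_bank_ne, t10]
      refine ⟨insert i T, insert e A, ?_, fun e' he' => ?_, ?_, ?_, ?_⟩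
      · rw [e9, e10]
        exact hfill.assign hpair hlt hc
      · by_cases hee : e' = e
        · simp [Store.write_apply, hee]
        · simp [Store.write_apply, hee, t11, hA e' he']
      · rw [card_insert_of_notMem hiT]
        simp [Store.write_apply]
      · rw [e9]
        have := total_update (W := s 9) hpair.lt_s q
        simp only [Store.write_apply, and_self, if_true]
        omega
      · rw [e9]
        rcases hopt with ⟨h1, h2⟩ | h1
        · refine Or.inl ⟨h1.assign hfill hpair hlt hc hmin, ?_⟩
          rw [card_insert_of_notMem hiT, h2]
        · refine Or.inr (h1.mono ?_)
          have := total_update (W := s 9) hpair.lt_s q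
          omega
    · have hz : (Expr.mul (.fits (capLE (.var 22)) (.var 12)) (.lt (.const 0) (.var 20))).eval t = 0 := by
        by_contra hne
        exact hc (htest.1 hne).1
      have hrun : commit.run t = t := by
        simp only [commit, run]
        rw [if_pos hz]
      rw [hrun]
      refine ⟨T, A, by rwa [t9, t10], by rwa [t11], by rwa [t12], by rwa [t13, t9], Or.inr ?_⟩
      rw [t9]
      exact hopt.elim (fun h => h.1.best_of_card_eq (not_lt.1 hc)) id

/-- As many rounds as there are edges suffice: if each one made a sale, then `m` slots are filled,
and the truncated capacity of the item is at most `m`. -/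
theorem trial_spec {u q : ℕ} (hr : Ready inp s) (hu : s 22 0 = u) (hq : s 18 0 = q)
    (h28 : s 28 0 = (data inp).total (s 6)) :
    (∃ T A, (data inp).Fill u q (s 6) (s 7) T A ((trial.run s) 9) ((trial.run s) 10)) ∧
      (trial.run s) 13 0 = (data inp).total ((trial.run s) 9) ∧
      (data inp).Best u q (s 6) ((trial.run s) 9) := by
  set s₁ := (copy 9 10 6 7).run s with hs₁
  have hm : s 0 2 = inp 2 := by rw [hr.input]
  have h1 : ∀ i < inp 2, s₁ 9 i = s 6 i ∧ s₁ 10 i = s 7 i := by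
    rw [← hm]
    exact copy_spec (by decide) (by decide) (by decide) (by decide) (by decide) (by decide)
      (by decide) (by decide) (by decide) s
  set s₂ := (LoopProg.loop 27 2 (.assign 11 (.var 27) (.const 0))).run s₁ with hs₂
  have hm₁ : s₁ 0 2 = inp 2 := by rw [hs₁, run_frame _ _ _ (by decide), hm]
  have h2 : ∀ e < inp 2, s₂ 11 e = 0 := by
    rw [← hm₁]
    refine run_loop_induction (fun k s' => ∀ e < k, s' 11 e = 0) (by simp) ?_
    intro k hk s' hs' hfr ih e he
    by_cases hek : e = k
    · simp [run, Expr.eval, Store.write_apply, hs', hek]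
    · simp [run, Expr.eval, Store.write_apply, hs', hek, ih e (by omega)]
  have hfr₂ : ∀ b, b ∉ [9, 10, 11, 27] → s₂ b = s b := by
    intro b hb
    rw [hs₂, run_frame _ _ _ (by simp [writes] at hb ⊢; tauto), hs₁,
      run_frame _ _ _ (by simp [writes, copy] at hb ⊢; tauto)]
  have h29 : s₂ 9 = s₁ 9 := run_frame _ _ _ (by decide)
  have h210 : s₂ 10 = s₁ 10 := run_frame _ _ _ (by decide)
  set s₃ := (s₂.write 12 0 0).write 13 0 (s 28 0) with hs₃
  have hrun : trial.run s = (LoopProg.loop 24 2 (.seq scan commit)).run s₃ := by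
    have : s₂ 28 = s 28 := hfr₂ 28 (by decide)
    simp only [trial, run, ← hs₁]
    simp only [run] at hs₂
    rw [← hs₂]
    simp [Expr.eval, Store.write_bank_ne, hs₃, this]
  have hfr₃ : ∀ b, b ∉ [9, 10, 11, 12, 13, 27] → s₃ b = s b := by
    intro b hb
    simp only [List.mem_cons, List.not_mem_nil, or_false, not_or] at hb
    rw [hs₃, Store.write_bank_ne _ _ _ (by tauto), Store.write_bank_ne _ _ _ (by tauto),
      hfr₂ b (by simp; tauto)]
  have hm₃ : s₃ 0 2 = inp 2 := by rw [hfr₃ 0 (by decide), hm]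
  have hloop : TrialInv inp u q (s 6) (s 7) (s₃ 0 2)
      ((LoopProg.loop 24 2 (.seq scan commit)).run s₃) := by
    refine run_loop_induction (fun k s' => TrialInv inp u q (s 6) (s 7) k s') ?_ ?_
    · have h9 : ∀ i < inp 2, s₃ 9 i = s 6 i := fun i hi => by
        rw [← (h1 i hi).1, ← h29, hs₃]
        simp [Store.write_bank_ne]
      have h10 : ∀ i < inp 2, s₃ 10 i = s 7 i := fun i hi => by
        rw [← (h1 i hi).2, ← h210, hs₃]
        simp [Store.write_bank_ne]
      refine ⟨∅, ∅, ?_, fun e he => ?_, ?_, ?_, Or.inl ⟨?_, rfl⟩⟩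
      · simp only [Store.write_bank_ne _ _ _ (show 9 ≠ 24 by decide),
          Store.write_bank_ne _ _ _ (show 10 ≠ 24 by decide)]
        exact Fill.refl h9 h10
      · simp [hs₃, Store.write_bank_ne, h2 e he]
      · simp [hs₃, Store.write_apply]
      · rw [Store.write_bank_ne _ _ _ (by decide), Store.write_bank_ne _ _ _ (by decide),
          total_congr (W' := s 6) h9, ← h28]
        simp [hs₃, Store.write_apply]
      · rw [Store.write_bank_ne _ _ _ (by decide)]
        exact Pending.refl h9
    · intro k hk s' hs' hfr ih
      have hfr' : ∀ b ∈ [0, 2, 3, 4, 18, 22], s' b = s b := by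
        intro b hb
        fin_cases hb <;> rw [hfr _ (by decide) (by decide), hfr₃ _ (by decide)]
      have hr' : Ready inp s' := hr.congr fun b hb => hfr' b (by simp at hb ⊢; tauto)
      have h := ih.round hr' (by rw [hfr' 22 (by decide), hu]) (by rw [hfr' 18 (by decide), hq])
      obtain ⟨T, A, g1, g2, g3, g4, g5⟩ := h
      refine ⟨T, A, ?_, ?_, ?_, ?_, ?_⟩ <;>
        simpa only [Store.write_bank_ne _ _ _ (show 9 ≠ 24 by decide),
          Store.write_bank_ne _ _ _ (show 10 ≠ 24 by decide),
          Store.write_bank_ne _ _ _ (show 11 ≠ 24 by decide),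
          Store.write_bank_ne _ _ _ (show 12 ≠ 24 by decide),
          Store.write_bank_ne _ _ _ (show 13 ≠ 24 by decide), run]
  rw [← hrun, hm₃] at hloop
  obtain ⟨T, A, g1, -, -, g4, g5⟩ := hloop
  refine ⟨⟨T, A, g1⟩, g4, ?_⟩
  rcases g5 with ⟨g5, g6⟩ | g5
  · exact g5.best_of_card_eq (g6 ▸ effCap_le _ _)
  · exact g5

/-! #### Processing an item -/

/-- The invariant of the trials for an item. -/
def CandidateInv (inp : ℕ → ℕ) (u : ℕ) (W S : ℕ → ℕ) (k : ℕ) (s : Store) : Prop :=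
  (∃ T A, (data inp).Fill u (s 17 0) W S T A (s 14) (s 15)) ∧
    s 16 0 = (data inp).total (s 14) ∧
    ∀ e < k, (data inp).left e = u → (data inp).Best u ((data inp).budget e) W (s 14)

/-- `Best` depends on the new prices only through a lower bound for their total. Keeping the trial
with the larger total therefore preserves it for all budgets tried so far. -/
theorem CandidateInv.step {u k : ℕ} (hr : Ready inp s) (hu : s 22 0 = u) (hk : s 23 0 = k)
    (hkm : k < inp 2) (h28 : s 28 0 = (data inp).total (s 6))
    (h : CandidateInv inp u (s 6) (s 7) k s) :
    CandidateInv inp u (s 6) (s 7) (k + 1) (candidate.run s) := by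
  obtain ⟨hfill, htot, hbest⟩ := h
  by_cases hl : (data inp).left k = u
  · set s₁ := s.write 18 0 ((data inp).budget k) with hs₁
    have hfr₁ : ∀ b, b ≠ 18 → s₁ b = s b := fun b hb => Store.write_bank_ne _ _ _ hb
    have hrun : candidate.run s = keep.run (trial.run s₁) := by
      have ht : (Expr.eq (leftE (.var 23)) (.var 22)).eval s ≠ 0 := by
        simp [Expr.eval, Op.eval, leftE_eval, hr.input, hk, hu, hl]
      simp only [candidate, run]
      rw [if_neg ht]
      simp [Expr.eval, hk, hr.budget k hkm, hs₁]
    obtain ⟨hfill', htot', hbest'⟩ := trial_spec (inp := inp) (s := s₁) (u := u)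
      (q := (data inp).budget k) (hr.congr fun b hb => hfr₁ b (by rintro rfl; simp at hb))
      (by rw [hfr₁ 22 (by decide), hu]) (by simp [hs₁, Store.write_apply])
      (by rw [hfr₁ 28 (by decide), hfr₁ 6 (by decide), h28])
    rw [hfr₁ 6 (by decide)] at hfill' hbest'
    rw [hfr₁ 7 (by decide)] at hfill'
    set t := trial.run s₁ with ht
    have hfrt : ∀ b ∈ [0, 14, 15, 16, 17], t b = s b := by
      intro b hb
      fin_cases hb <;> rw [ht, run_frame _ _ _ (by decide), hfr₁ _ (by decide)]
    have t18 : t 18 0 = (data inp).budget k := by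
      rw [ht, run_frame _ _ _ (by decide)]
      simp [hs₁, Store.write_apply]
    rw [hrun]
    have htest : (Expr.lt (.var 16) (.var 13)).eval t ≠ 0 ↔ s 16 0 < t 13 0 := by
      simp [Expr.eval, Op.eval, hfrt 16 (by decide)]
    by_cases hlt : s 16 0 < t 13 0
    · set t₁ := (t.write 16 0 (t 13 0)).write 17 0 ((data inp).budget k) with ht₁
      have hkeep : keep.run t = (copy 14 15 9 10).run t₁ := by
        simp only [keep, run]
        rw [if_neg (htest.2 hlt)]
        simp [Expr.eval, Store.write_bank_ne, ht₁, t18]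
      have hm : t₁ 0 2 = inp 2 := by
        simp [ht₁, Store.write_bank_ne, hfrt 0 (by decide), hr.input]
      have hcopy := copy_spec (a := 14) (b := 15) (a' := 9) (b' := 10) (by decide) (by decide)
        (by decide) (by decide) (by decide) (by decide) (by decide) (by decide) (by decide) t₁
      rw [← hkeep, hm] at hcopy
      have h9 : t₁ 9 = t 9 := by simp [ht₁, Store.write_bank_ne]
      have h10 : t₁ 10 = t 10 := by simp [ht₁, Store.write_bank_ne]
      rw [h9, h10] at hcopy
      have h14 : ∀ i < (data inp).m, (keep.run t) 14 i = t 9 i := fun i hi => (hcopy i hi).1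
      have h15 : ∀ i < (data inp).m, (keep.run t) 15 i = t 10 i := fun i hi => (hcopy i hi).2
      have k16 : (keep.run t) 16 0 = t 13 0 := by
        rw [hkeep, run_frame _ _ _ (by decide)]
        simp [ht₁, Store.write_apply]
      have k17 : (keep.run t) 17 0 = (data inp).budget k := by
        rw [hkeep, run_frame _ _ _ (by decide)]
        simp [ht₁, Store.write_apply]
      have htot14 : (data inp).total ((keep.run t) 14) = t 13 0 := by
        rw [total_congr h14, htot']
      refine ⟨?_, by rw [k16, htot14], fun e he hle => ?_⟩
      · rw [k17]
        obtain ⟨T, A, hf⟩ := hfill'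
        exact ⟨T, A, hf.congr h14 h15⟩
      · by_cases hek : e = k
        · rw [hek]
          exact hbest'.congr h14
        · refine (hbest e (by omega) hle).mono ?_
          rw [htot14, ← htot]
          exact hlt.le
    · have hkeep : keep.run t = t := by
        simp only [keep, run]
        rw [if_pos (by simpa using mt htest.1 hlt)]
      rw [hkeep]
      have t14 := hfrt 14 (by decide)
      have t15 := hfrt 15 (by decide)
      have t16 := hfrt 16 (by decide)
      have t17 := hfrt 17 (by decide)
      refine ⟨by rwa [t14, t15, t17], by rwa [t14, t16], fun e he hle => ?_⟩
      rw [t14]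
      by_cases hek : e = k
      · rw [hek]
        refine hbest'.mono ?_
        omega
      · exact hbest e (by omega) hle
  · have hz : (Expr.eq (leftE (.var 23)) (.var 22)).eval s = 0 := by
      simp [Expr.eval, Op.eval, leftE_eval, hr.input, hk, hu, hl]
    have hrun : candidate.run s = s := by
      simp only [candidate, run]
      rw [if_pos hz]
    rw [hrun]
    refine ⟨hfill, htot, fun e he hle => ?_⟩
    by_cases hek : e = k
    · exact (hl (hek ▸ hle)).elim
    · exact hbest e (by omega) hle

/-- The invariant of the loop over the items. -/
structure VertexInv (inp : ℕ → ℕ) (u : ℕ) (s : Store) : Prop where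
  ready : Ready inp s
  total : s 16 0 = (data inp).total (s 6)
  state : (data inp).State u (s 6) (s 7) (s 8)
  competitive : (data inp).Competitive u (s 6)

/-- After the candidate loop the kept trial is best for the budget of every customer of `u`, which
is what `Competitive.step` requires. -/
theorem VertexInv.step {u : ℕ} (h : VertexInv inp u s) (hu : s 22 0 = u) :
    VertexInv inp (u + 1) (vertex.run s) := by
  have hr := h.ready
  set s₁ := s.write 28 0 (s 16 0) with hs₁
  have hfr₁ : ∀ b, b ≠ 28 → s₁ b = s b := fun b hb => Store.write_bank_ne _ _ _ hb
  set s₂ := (copy 14 15 6 7).run s₁ with hs₂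
  have hfr₂ : ∀ b, b ∉ [14, 15, 27, 28] → s₂ b = s b := by
    intro b hb
    rw [hs₂, run_frame _ _ _ (by simp [writes, copy] at hb ⊢; tauto), hfr₁ b (by simp at hb; tauto)]
  have h28 : s₂ 28 0 = (data inp).total (s 6) := by
    rw [hs₂, run_frame _ _ _ (by decide), ← h.total]
    simp [hs₁, Store.write_apply]
  have hcopy : ∀ i < inp 2, s₂ 14 i = s 6 i ∧ s₂ 15 i = s 7 i := by
    have := copy_spec (a := 14) (b := 15) (a' := 6) (b' := 7) (by decide) (by decide)
      (by decide) (by decide) (by decide) (by decide) (by decide) (by decide) (by decide) s₁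
    rwa [hfr₁ 0 (by decide), hfr₁ 6 (by decide), hfr₁ 7 (by decide), hr.input] at this
  have hm₂ : s₂ 0 2 = inp 2 := by rw [hfr₂ 0 (by decide), hr.input]
  set s₃ := (LoopProg.loop 23 2 candidate).run s₂ with hs₃
  have hcand : CandidateInv inp u (s 6) (s 7) (s₂ 0 2) s₃ := by
    refine run_loop_induction (fun k s' => CandidateInv inp u (s 6) (s 7) k s') ?_ ?_
    -- Selling nothing is the first best trial. It is a fill at any price, so a value left in bank
    -- 17 by an earlier item does no harm.
    · refine ⟨⟨∅, ∅, ?_⟩, ?_, by simp⟩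
      · simp only [Store.write_bank_ne _ _ _ (show 14 ≠ 23 by decide),
          Store.write_bank_ne _ _ _ (show 15 ≠ 23 by decide)]
        exact Fill.refl (fun i hi => (hcopy i hi).1) (fun i hi => (hcopy i hi).2)
      · rw [Store.write_bank_ne _ _ _ (by decide), Store.write_bank_ne _ _ _ (by decide),
          hfr₂ 16 (by decide), h.total]
        exact (total_congr fun i hi => (hcopy i hi).1).symm
    · intro k hk s' hs' hfr ih
      have hfr' : ∀ b ∈ [0, 2, 3, 4, 6, 7, 22], s' b = s b := by
        intro b hb
        fin_cases hb <;> rw [hfr _ (by decide) (by decide), hfr₂ _ (by decide)]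
      have hstep := CandidateInv.step (inp := inp) (s := s') (u := u) (k := k)
        (hr.congr fun b hb => hfr' b (by simp at hb ⊢; tauto))
        (by rw [hfr' 22 (by decide), hu]) hs' (hm₂ ▸ hk)
        (by rw [hfr 28 (by decide) (by decide), h28, hfr' 6 (by decide)])
        (by rwa [hfr' 6 (by decide), hfr' 7 (by decide)])
      rw [hfr' 6 (by decide), hfr' 7 (by decide)] at hstep
      obtain ⟨g1, g2, g3⟩ := hstep
      refine ⟨?_, ?_, ?_⟩ <;>
        simpa only [Store.write_bank_ne _ _ _ (show 14 ≠ 23 by decide),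
          Store.write_bank_ne _ _ _ (show 15 ≠ 23 by decide),
          Store.write_bank_ne _ _ _ (show 16 ≠ 23 by decide),
          Store.write_bank_ne _ _ _ (show 17 ≠ 23 by decide)]
  rw [hm₂] at hcand
  obtain ⟨⟨T, A, hfill⟩, htot, hbest⟩ := hcand
  have hfr₃ : ∀ b ∈ [0, 2, 3, 4, 8, 22], s₃ b = s b := by
    intro b hb
    fin_cases hb <;> rw [hs₃, run_frame _ _ _ (by decide), hfr₂ _ (by decide)]
  set s₄ := (copy 6 7 14 15).run s₃ with hs₄
  have hcopy' : ∀ i < inp 2, s₄ 6 i = s₃ 14 i ∧ s₄ 7 i = s₃ 15 i := by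
    have := copy_spec (a := 6) (b := 7) (a' := 14) (b' := 15) (by decide) (by decide)
      (by decide) (by decide) (by decide) (by decide) (by decide) (by decide) (by decide) s₃
    rwa [hfr₃ 0 (by decide), hr.input] at this
  have h6 : ∀ i < (data inp).m, s₄ 6 i = s₃ 14 i := fun i hi => (hcopy' i hi).1
  have h7 : ∀ i < (data inp).m, s₄ 7 i = s₃ 15 i := fun i hi => (hcopy' i hi).2
  have hfr₄ : ∀ b ∈ [0, 2, 3, 4, 8, 22], s₄ b = s b := by
    intro b hb
    rw [← hfr₃ b hb]
    fin_cases hb <;> exact run_frame _ _ _ (by decide)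
  have h16 : s₄ 16 = s₃ 16 := run_frame _ _ _ (by decide)
  have h17 : s₄ 17 = s₃ 17 := run_frame _ _ _ (by decide)
  have hrun : vertex.run s = s₄.write 8 u (s₃ 17 0) := by
    simp only [run] at hs₃
    simp only [vertex, run]
    rw [show (Expr.const 0).eval s = 0 from rfl, show (Expr.var 16).eval s = s 16 0 from rfl, ← hs₁,
      ← hs₂, ← hs₃, ← hs₄]
    simp [Expr.eval, hfr₄ 22 (by decide), hu, h17]
  have hfill' := hfill.congr h6 h7
  rw [hrun]
  refine ⟨hr.congr fun b hb => ?_, ?_, ?_, ?_⟩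
  · rw [Store.write_bank_ne _ _ _ (by rintro rfl; simp at hb), hfr₄ b (by simp at hb ⊢; tauto)]
  · rw [Store.write_bank_ne _ _ _ (by decide), Store.write_bank_ne _ _ _ (by decide), h16, htot]
    exact (total_congr h6).symm
  · rw [Store.write_bank_ne _ _ _ (by decide), Store.write_bank_ne _ _ _ (by decide),
      Store.write_bank, hfr₄ 8 (by decide)]
    exact h.state.step hfill'
  · rw [Store.write_bank_ne _ _ _ (by decide)]
    exact h.competitive.step (fun i hi => hfill'.le_new hi) fun e he hle => (hbest e he hle).congr h6

/-! #### Output -/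

/-- The second clause keeps the indicator cells at zero for `writeServed_spec`, where only the ones
are written. -/
theorem writePrices_spec (s : Store) :
    (∀ u < s 0 0, (writePrices.run s) 1 (2 * u) = s 8 u ∧ (writePrices.run s) 1 (2 * u + 1) = s 2 0) ∧
      ∀ i, 2 * s 0 0 ≤ i → (writePrices.run s) 1 i = s 1 i := by
  have := run_loop_induction (x := 22) (j := 0) (s := s)
    (c := .seq (.assign 1 (.add (.var 22) (.var 22)) (.read 8 (.var 22)))
      (.assign 1 (.add (.add (.var 22) (.var 22)) (.const 1)) (.var 2)))
    (fun k s' => (∀ u < k, s' 1 (2 * u) = s 8 u ∧ s' 1 (2 * u + 1) = s 2 0) ∧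
      ∀ i, 2 * k ≤ i → s' 1 i = s 1 i) ?_ ?_
  · exact this
  · simp [Store.write_bank_ne]
  · rintro k hk s' hs' hfr ⟨ih1, ih2⟩
    have h8 : s' 8 = s 8 := hfr 8 (by decide) (by decide)
    have h2 : s' 2 = s 2 := hfr 2 (by decide) (by decide)
    refine ⟨fun u hu => ?_, fun i hi => ?_⟩
    · have e1 : k + k ≠ k + k + 1 := by omega
      by_cases huk : u = k
      · simp [run, Expr.eval, Op.eval, Store.write_apply, hs', huk, two_mul, h8, h2]
      · have a1 : u + u ≠ k + k + 1 := by omega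
        have a2 : u + u ≠ k + k := by omega
        have a3 : u + u + 1 ≠ k + k + 1 := by omega
        have a4 : u + u + 1 ≠ k + k := by omega
        have := ih1 u (by omega)
        rw [two_mul] at this ⊢
        simp [run, Expr.eval, Op.eval, Store.write_apply, hs', a1, a2, a4, this]
    · have a1 : i ≠ k + k + 1 := by omega
      have a2 : i ≠ k + k := by omega
      simp [run, Expr.eval, Op.eval, Store.write_apply, hs', a1, a2, ih2 i (by omega)]

theorem writeServed_spec (s : Store) (h1 : ∀ i, 2 * s 0 0 ≤ i → s 1 i = 0) :
    (∀ i < 2 * s 0 0, (writeServed.run s) 1 i = s 1 i) ∧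
      ∀ e, (writeServed.run s) 1 (2 * s 0 0 + e) = if ∃ i < s 0 2, s 7 i = e + 1 then 1 else 0 := by
  refine run_loop_induction (fun k s' => (∀ i < 2 * s 0 0, s' 1 i = s 1 i) ∧
    ∀ e, s' 1 (2 * s 0 0 + e) = if ∃ i < k, s 7 i = e + 1 then 1 else 0) ?_ ?_
  · refine ⟨fun i hi => by simp [Store.write_bank_ne], fun e => ?_⟩
    simp [Store.write_bank_ne, h1]
  · rintro k hk s' hs' hfr ⟨ih1, ih2⟩
    have h7 : s' 7 = s 7 := hfr 7 (by decide) (by decide)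
    have h0 : s' 0 = s 0 := hfr 0 (by decide) (by decide)
    by_cases hz : s 7 k = 0
    · have ht : (Expr.lt (.const 0) (.read 7 (.var 26))).eval s' = 0 := by
        simp [Expr.eval, Op.eval, hs', h7, hz]
      simp only [run, if_pos ht, Store.write_bank_ne _ _ _ (show 1 ≠ 26 by decide)]
      refine ⟨ih1, fun e => ?_⟩
      rw [ih2]
      refine if_congr ⟨?_, ?_⟩ rfl rfl
      · rintro ⟨i, hi, hie⟩
        exact ⟨i, by omega, hie⟩
      · rintro ⟨i, hi, hie⟩
        refine ⟨i, ?_, hie⟩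
        have : i ≠ k := by
          rintro rfl
          omega
        omega
    · have ht : (Expr.lt (.const 0) (.read 7 (.var 26))).eval s' ≠ 0 := by
        simp [Expr.eval, Op.eval, hs', h7]
        omega
      simp only [run, if_neg ht, Store.write_bank_ne _ _ _ (show 1 ≠ 26 by decide)]
      have hw : ∀ i, (s'.write 1 ((Expr.add (.add (.read 0 (.const 0)) (.read 0 (.const 0)))
          (.sub (.read 7 (.var 26)) (.const 1))).eval s') ((Expr.const 1).eval s')) 1 i =
          if i = 2 * s 0 0 + (s 7 k - 1) then 1 else s' 1 i := by
        intro i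
        simp [Store.write_apply, Expr.eval, Op.eval, h0, h7, hs', two_mul]
      refine ⟨fun i hi => ?_, fun e => ?_⟩
      · rw [hw, if_neg (by omega), ih1 i hi]
      · rw [hw, ih2]
        by_cases he : s 7 k = e + 1
        · rw [if_pos (by omega), if_pos ⟨k, by omega, he⟩]
        · rw [if_neg (by omega)]
          refine if_congr ⟨?_, ?_⟩ rfl rfl
          · rintro ⟨i, hi, hie⟩
            exact ⟨i, by omega, hie⟩
          · rintro ⟨i, hi, hie⟩
            refine ⟨i, ?_, hie⟩
            have : i ≠ k := by
              rintro rfl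
              exact he hie
            omega

/-- The program computes a feasible and competitive solution of the integral instance. -/
theorem program_spec (inp : ℕ → ℕ) (s : Store) (h0 : s 0 = inp) (hz : ∀ b ≠ 0, ∀ i, s b i = 0) :
    ∃ W S P : ℕ → ℕ, (data inp).State (inp 0) W S P ∧ (data inp).Competitive (inp 0) W ∧
      (∀ u < inp 0, (program.run s) 1 (2 * u) = P u ∧
        (program.run s) 1 (2 * u + 1) = inputDen inp) ∧
      ∀ e < inp 2, (program.run s) 1 (2 * inp 0 + e) = if e ∈ (data inp).served S then 1 else 0 := by
  subst h0
  have hready := ready_preprocessing s (hz 5 (by decide))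
  set s₁ := validSlots.run (budgets.run (denominators.run s)) with hs₁
  have hfr₁ : ∀ b ∈ [1, 6, 7, 16], s₁ b = s b := by
    intro b hb
    fin_cases hb <;> rw [hs₁, run_frame _ _ _ (by decide), run_frame _ _ _ (by decide),
      run_frame _ _ _ (by decide)]
  set s₂ := (LoopProg.loop 22 0 vertex).run s₁ with hs₂
  have hinv : VertexInv (s 0) (s₁ 0 0) s₂ := by
    refine run_loop_induction (fun k s' => VertexInv (s 0) k s') ?_ ?_
    · have h6 : ∀ i, s₁ 6 i = 0 := fun i => by rw [hfr₁ 6 (by decide), hz 6 (by decide)]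
      have h7 : ∀ i, s₁ 7 i = 0 := fun i => by rw [hfr₁ 7 (by decide), hz 7 (by decide)]
      refine ⟨hready.congr fun b hb => Store.write_bank_ne _ _ _ (by rintro rfl; simp at hb), ?_, ?_,
        Competitive.zero _⟩
      · rw [Store.write_bank_ne _ _ _ (by decide), Store.write_bank_ne _ _ _ (by decide),
          hfr₁ 16 (by decide), hz 16 (by decide)]
        simp [SlotData.total, h6]
      · exact State.zero (fun i _ => by rw [Store.write_bank_ne _ _ _ (by decide), h6])
          (fun i _ => by rw [Store.write_bank_ne _ _ _ (by decide), h7]) _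
    · intro k hk s' hs' hfr ih
      have := ih.step hs'
      refine ⟨this.ready.congr fun b hb => Store.write_bank_ne _ _ _ (by rintro rfl; simp at hb),
        ?_, ?_, ?_⟩ <;> simp only [Store.write_bank_ne _ _ _ (show 6 ≠ 22 by decide),
          Store.write_bank_ne _ _ _ (show 7 ≠ 22 by decide),
          Store.write_bank_ne _ _ _ (show 8 ≠ 22 by decide),
          Store.write_bank_ne _ _ _ (show 16 ≠ 22 by decide)]
      exacts [this.total, this.state, this.competitive]
  rw [hready.input] at hinv
  have h20 : s₂ 0 = s 0 := hinv.ready.input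
  have h21 : ∀ i, s₂ 1 i = 0 := fun i => by
    rw [hs₂, run_frame _ _ _ (by decide), hfr₁ 1 (by decide), hz 1 (by decide)]
  obtain ⟨hp1, hp2⟩ := writePrices_spec s₂
  set s₃ := writePrices.run s₂ with hs₃
  have h30 : s₃ 0 = s 0 := (run_frame _ _ _ (by decide)).trans h20
  have h37 : s₃ 7 = s₂ 7 := run_frame _ _ _ (by decide)
  rw [h20] at hp1 hp2
  obtain ⟨hw1, hw2⟩ := writeServed_spec s₃ (by
    rw [h30]
    exact fun i hi => (hp2 i hi).trans (h21 i))
  have hrun : program.run s = writeServed.run s₃ := by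
    rw [hs₃, hs₂, hs₁]
    rfl
  rw [← hrun, h30] at hw1 hw2
  rw [h37] at hw2
  refine ⟨s₂ 6, s₂ 7, s₂ 8, hinv.state, hinv.competitive, fun u hu => ?_, fun e he => ?_⟩
  · rw [hw1 _ (by omega), hw1 _ (by omega), (hp1 u hu).1, (hp1 u hu).2, hinv.ready.den]
    exact ⟨rfl, rfl⟩
  · rw [hw2]
    refine if_congr ?_ rfl rfl
    simp only [served, mem_filter, mem_range]
    exact ⟨fun h => ⟨he, h⟩, fun h => h.2⟩

end Pricing

/-! ### From the integral instance back to the rational input -/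

namespace PricingInput

open Finset Pricing SlotData

theorem getD_append_ofFn {n : ℕ} (l l' : List ℕ) (f : Fin n → ℕ) (i : Fin n) {k : ℕ}
    (hk : k = l.length + i) : (l ++ List.ofFn f ++ l').getD k 0 = f i := by
  subst hk
  rw [List.getD_eq_getElem?_getD, List.append_assoc, List.getElem?_append_right (by omega),
    Nat.add_sub_cancel_left, List.getElem?_append_left (by simp)]
  simp

variable (X : PricingInput)

/-- The contents of the input bank. -/
noncomputable def input (i : ℕ) : ℕ := X.encode.getD i 0

@[simp] theorem input_zero : X.input 0 = X.numL := by simp [input, encode]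

@[simp] theorem input_one : X.input 1 = X.numR := by simp [input, encode]

@[simp] theorem input_two : X.input 2 = X.numE := by simp [input, encode]

theorem input_capL (u : Fin X.numL) : X.input (3 + u) = encodeCap (X.capL u) := by
  rw [input, encode]
  simp only [List.append_assoc]
  rw [← List.append_assoc]
  exact getD_append_ofFn _ _ (fun u => encodeCap (X.capL u)) u rfl

theorem input_capR (v : Fin X.numR) : X.input (3 + X.numL + v) = encodeCap (X.capR v) := by
  rw [input, encode, List.append_assoc, List.append_assoc, List.append_assoc]
  exact getD_append_ofFn _ _ (fun v => encodeCap (X.capR v)) v (by simp; omega)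

theorem input_left (e : Fin X.numE) : X.input (block X.input 0 + e) = X.left e := by
  rw [input, encode, List.append_assoc, List.append_assoc]
  exact getD_append_ofFn _ _ (fun e => (X.left e : ℕ)) e (by simp [block]; omega)

theorem input_right (e : Fin X.numE) : X.input (block X.input 1 + e) = X.right e := by
  rw [input, encode, List.append_assoc]
  exact getD_append_ofFn _ _ (fun e => (X.right e : ℕ)) e (by simp [block]; omega)

theorem input_num (e : Fin X.numE) : X.input (block X.input 2 + e) = (X.budget e).num := by
  rw [input, encode]
  exact getD_append_ofFn _ _ (fun e => (X.budget e).num) e (by simp [block]; omega)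

theorem input_den (e : Fin X.numE) : X.input (block X.input 3 + e) = (X.budget e).den := by
  rw [input, encode, ← List.append_nil (_ ++ List.ofFn fun e => (X.budget e).den)]
  exact getD_append_ofFn _ _ (fun e => (X.budget e).den) e (by simp [block]; omega)

theorem inputDen_input : inputDen X.input = X.commonDen := by
  rw [inputDen, prod_range, commonDen, input_two]
  exact prod_congr rfl fun e _ => X.input_den e

@[simp] theorem data_m : (data X.input).m = X.numE := X.input_two

theorem data_left (e : Fin X.numE) : (data X.input).left e = X.left e := X.input_left e

theorem data_right (e : Fin X.numE) : (data X.input).right e = X.right e := X.input_right e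

theorem data_budget (e : Fin X.numE) : (data X.input).budget e = X.scaledBudget e := by
  rw [scaledBudget, ← inputDen_input, ← input_den, ← input_num]
  rfl

theorem data_capL (u : Fin X.numL) :
    (data X.input).capL u = effCap X.numE (encodeCap (X.capL u)) := by
  rw [← input_capL, ← input_two]
  rfl

theorem data_capR (v : Fin X.numR) :
    (data X.input).capR v = effCap X.numE (encodeCap (X.capR v)) := by
  rw [← input_capR, ← input_two, ← input_zero]
  rfl

/-- Truncating a capacity at the number of edges changes nothing, because no set of customers is
larger. -/
theorem le_effCap_encodeCap {m n : ℕ} (hn : n ≤ m) (c : ℕ∞) :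
    n ≤ effCap m (encodeCap c) ↔ (n : ℕ∞) ≤ c := by
  cases c with
  | top => simp [encodeCap, effCap, hn]
  | coe c => simp [encodeCap, effCap, hn]

theorem card_filter_map_val {m : ℕ} (F : Finset (Fin m)) (p : ℕ → Prop) [DecidablePred p] :
    (#{e ∈ F.map Fin.valEmbedding | p e} : ℕ∞) = Set.encard {e : Fin m | e ∈ F ∧ p e} := by
  rw [filter_map, card_map, ← Set.encard_coe_eq_coe_finsetCard]
  congr 1
  ext e
  simp

/-- Capacity constraints of an input and of the integral instance agree. -/
theorem card_le_effCap_iff {V : ℕ} (F : Finset (Fin X.numE)) (f : Fin X.numE → Fin V)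
    (cap : Fin V → ℕ∞) (g : ℕ → ℕ) (hg : ∀ e : Fin X.numE, g e = f e) (v : Fin V) :
    #{e ∈ F.map Fin.valEmbedding | g e = v} ≤ effCap X.numE (encodeCap (cap v)) ↔
      Set.encard {e : Fin X.numE | e ∈ F ∧ f e = v} ≤ cap v := by
  have hm : #{e ∈ F.map Fin.valEmbedding | g e = v} ≤ X.numE :=
    (card_filter_le _ _).trans (by simpa using card_le_univ F)
  rw [le_effCap_encodeCap hm, card_filter_map_val]
  simp only [hg, Fin.val_inj]

/-- The integral instance is indexed by all naturals; beyond the actual vertices there are no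
customers in `F`. -/
theorem card_le_of_forall {V : ℕ} (F : Finset (Fin X.numE)) (f : Fin X.numE → Fin V)
    (g : ℕ → ℕ) (hg : ∀ e : Fin X.numE, g e = f e) (cap : ℕ → ℕ)
    (h : ∀ v : Fin V, #{e ∈ F.map Fin.valEmbedding | g e = v} ≤ cap v) (v : ℕ) :
    #{e ∈ F.map Fin.valEmbedding | g e = v} ≤ cap v := by
  by_cases hv : v < V
  · exact h ⟨v, hv⟩
  · have : {e ∈ F.map Fin.valEmbedding | g e = v} = ∅ := by
      refine filter_eq_empty_iff.2 fun e he hge => hv ?_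
      obtain ⟨e, -, rfl⟩ := mem_map.1 he
      rw [← hge, Fin.valEmbedding_apply, hg]
      exact (f e).2
    simp [this]

/-- A competitive solution of the integral instance is a 2-approximation. -/
theorem isApproxSolution_of_competitive {W S P out : ℕ → ℕ}
    (hS : (data X.input).State X.numL W S P) (hW : (data X.input).Competitive X.numL W)
    (hP : ∀ u < X.numL, out (2 * u) = P u ∧ out (2 * u + 1) = X.commonDen)
    (hF : ∀ e < X.numE, out (2 * X.numL + e) = if e ∈ (data X.input).served S then 1 else 0) :
    IsApproxSolution 2 X out := by
  have hD : (0 : ℝ≥0) < X.commonDen := by exact_mod_cast X.commonDen_pos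
  set p : Fin X.numL → ℝ≥0 := fun u => P u / X.commonDen with hp
  set F : Finset (Fin X.numE) := {e | (e : ℕ) ∈ (data X.input).served S} with hFdef
  have hmap : F.map Fin.valEmbedding = (data X.input).served S := by
    ext e
    simp only [hFdef, mem_map, mem_filter, mem_univ, true_and, Fin.valEmbedding_apply]
    constructor
    · rintro ⟨e, he, rfl⟩
      exact he
    · intro he
      have hlt : e < X.numE := by
        rw [← data_m]
        exact mem_range.1 (mem_filter.1 he).1
      exact ⟨⟨e, hlt⟩, he, rfl⟩
  have hrev : X.commonDen * X.toInstance.revenue p F = (data X.input).total W := by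
    rw [← hS.sum_served, ← hmap, sum_map, Nat.cast_sum, PricingInstance.revenue, mul_sum]
    refine sum_congr rfl fun e _ => ?_
    rw [Fin.valEmbedding_apply, data_left, hp, mul_div_cancel₀ _ hD.ne']
    rfl
  refine ⟨p, F, ⟨fun u => ?_, fun e => ?_⟩, ⟨fun e he => ?_, fun u => ?_, fun v => ?_⟩,
    fun p' F' hfeas => ?_⟩
  · rw [(hP u u.2).1, (hP u u.2).2]
    exact ⟨X.commonDen_pos.ne', rfl⟩
  · rw [hF e e.2]
    simp [hFdef]
  · have h1 := hS.le_budget (mem_filter.1 he).2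
    rw [data_left, data_budget] at h1
    refine (div_le_iff₀' hD).2 ?_
    rw [← scaledBudget_cast]
    exact_mod_cast h1
  · refine (X.card_le_effCap_iff F X.left X.capL _ X.data_left u).1 ?_
    rw [hmap, ← data_capL]
    exact hS.card_left u
  · refine (X.card_le_effCap_iff F X.right X.capR _ X.data_right v).1 ?_
    rw [hmap, ← data_capR]
    exact hS.card_right v
  · obtain ⟨q, hq, hle, hqB⟩ := X.toInstance.exists_budget_prices hfeas
    -- The floor merely yields an integer everywhere. At items sold in `F'` the scaled price is a
    -- scaled budget, and there the floor is exact.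
    set r : ℕ → ℕ := fun u => if h : u < X.numL then ⌊X.commonDen * q ⟨u, h⟩⌋₊ else 0 with hr
    have hrq : ∀ e ∈ F', ∃ e', X.left e' = X.left e ∧ r (X.left e) = X.scaledBudget e' ∧
        (X.scaledBudget e' : ℝ≥0) = X.commonDen * q (X.left e) := by
      intro e he
      obtain ⟨e', -, h1, h2⟩ := hqB e he
      have h3 : (X.scaledBudget e' : ℝ≥0) = X.commonDen * q (X.left e) := by
        rw [scaledBudget_cast, ← h2]
        rfl
      refine ⟨e', h1, ?_, h3⟩
      simp only [hr, (X.left e).2, dif_pos, Fin.eta]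
      rw [← h3, Nat.floor_natCast]
    have hsum := hW.sum_le (F := F'.map Fin.valEmbedding) (p := r) (fun e he => by
        obtain ⟨e, -, rfl⟩ := mem_map.1 he
        simp)
      (X.card_le_of_forall F' X.left _ X.data_left _ fun u => by
        rw [data_capL]
        exact (X.card_le_effCap_iff F' X.left X.capL _ X.data_left u).2 (hq.2.1 u))
      (X.card_le_of_forall F' X.right _ X.data_right _ fun v => by
        rw [data_capR]
        exact (X.card_le_effCap_iff F' X.right X.capR _ X.data_right v).2 (hq.2.2 v))
      (fun e he => by
        obtain ⟨e, -, rfl⟩ := mem_map.1 he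
        rw [Fin.valEmbedding_apply, data_left]
        exact (X.left e).2)
      (fun e he => by
        obtain ⟨e, he', rfl⟩ := mem_map.1 he
        obtain ⟨e', -, h2, h3⟩ := hrq e he'
        rw [Fin.valEmbedding_apply, data_left, data_budget, h2]
        have : (X.scaledBudget e' : ℝ≥0) ≤ X.scaledBudget e := by
          rw [h3, scaledBudget_cast]
          exact mul_le_mul_of_nonneg_left (hq.1 e he') hD.le
        exact_mod_cast this)
      (fun e he => by
        obtain ⟨e, he', rfl⟩ := mem_map.1 he
        obtain ⟨e', h1, h2, -⟩ := hrq e he'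
        refine ⟨e', by simp, ?_, ?_⟩
        · rw [Fin.valEmbedding_apply, data_left, data_left, h1]
        · rw [Fin.valEmbedding_apply, data_left, data_budget, h2])
    have hrev' : X.commonDen * X.toInstance.revenue q F' =
        ((∑ e ∈ F'.map Fin.valEmbedding, r ((data X.input).left e) : ℕ) : ℝ≥0) := by
      rw [sum_map, Nat.cast_sum, PricingInstance.revenue, mul_sum]
      refine sum_congr rfl fun e he => ?_
      obtain ⟨e', -, h2, h3⟩ := hrq e he
      rw [Fin.valEmbedding_apply, data_left, h2, h3]
      rfl
    refine hle.trans (le_of_mul_le_mul_left ?_ hD)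
    rw [hrev', mul_left_comm, hrev]
    exact_mod_cast hsum

theorem polyTimeSolvable : RAM.PolyTimeSolvable encode (IsApproxSolution 2) := by
  refine .of_loopProg program program_tame (fun X j hj => ?_) fun X => ?_
  · change X.input j ≤ X.size
    interval_cases j
    · exact X.input_zero.trans_le X.numL_le_size
    · exact X.input_one.trans_le X.numR_le_size
    · exact X.input_two.trans_le X.numE_le_size
  · obtain ⟨W, S, P, h1, h2, h3, h4⟩ := program_spec X.input (RAM.initStore X.encode)
      (by ext i; simp [RAM.initStore, input]) (fun b hb i => by simp [RAM.initStore, hb])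
    rw [input_zero] at h1 h2 h3 h4
    rw [input_two] at h4
    rw [inputDen_input] at h3
    exact X.isApproxSolution_of_competitive h1 h2 h3 h4

end PricingInput

theorem mainTheorem1 :
    -- there is a polynomial-time 2-approximation algorithm
    RAM.PolyTimeSolvable PricingInput.encode (PricingInput.IsApproxSolution 2) ∧
    -- every locally optimal pricing has at least half of the value of every pricing
    (∀ (L R E : Type*) [Finite L] [Finite R] [Fintype E] (I : PricingInstance L R E)
        (p : L → ℝ≥0), I.LocallyOptimal p → ∀ p' : L → ℝ≥0, I.val p' / 2 ≤ I.val p) ∧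
    -- best-improvement local search reaches such a value after polynomially many iterations
    (∃ P : Polynomial ℕ, ∀ (X : PricingInput) (p : ℕ → Fin X.numL → ℝ≥0),
        X.toInstance.IsBudgetPricing (p 0) →
        (∀ k : ℕ, X.toInstance.IsBestSwap (p k) (p (k + 1))) →
        ∀ k : ℕ, P.eval X.size ≤ k →
          ∀ p' : Fin X.numL → ℝ≥0, X.toInstance.val p' / 2 ≤ X.toInstance.val (p k)) := by
  refine ⟨PricingInput.polyTimeSolvable, fun L R E _ _ _ I p hp p' => hp.half_val_le p',
    -- The bound `numL * (3 * size)` with `numL` at most `size`.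
    3 * Polynomial.X ^ 2, fun X p h0 hp k hk p' => X.half_val_le_of_isBestSwap p h0 hp k ?_ p'⟩
  refine le_trans ?_ hk
  have h1 : X.numL * (3 * X.size) ≤ X.size * (3 * X.size) := Nat.mul_le_mul_right _ X.numL_le_size
  simp only [Polynomial.eval_mul, Polynomial.eval_pow, Polynomial.eval_X, Polynomial.eval_ofNat]
  refine h1.trans_eq ?_
  ring
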